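/- Set $\mathcal O=\mathbb C[[t]]$ and $\mathcal K=\mathbb C((t))$, let $m\ge 0$, and let $\mathrm{Gr}=GL_m(\mathcal K)/GL_m(\mathcal O)$ be the affine Grassmannian, viewed as the set of lattices $L=g\mathcal O^m\subset\mathcal K^m$, $g\in GL_m(\mathcal K)$. For $\nu\in\mathbb N^m$ let $t^\nu=\mathrm{diag}(t^{\nu_1},\dots,t^{\nu_m})$, let $\mathrm{Gr}^\nu=GL_m(\mathcal O)t^\nu\subset\mathrm{Gr}$, and let $S^\nu_-=N_-(\mathcal K)t^\nu\subset\mathrm{Gr}$, where $N_-$ is the group of lower-triangular matrices with $1$s on the diagonal. For $1\le i\le m$ let $L_{[1,i]}\subset\mathcal K^i$ be the image of $L$ under the projection to the first $i$ coordinates. Let $\tau$ be a semistandard Young tableau of shape $\lambda$ with entries in $\{1,\dots,m\}$ and weight $\mu=(\mu_1,\dots,\mu_m)$ (so $\mu_i$ is the number of boxes with entry $i$), and assume $\mu_1\ge\cdots\ge\mu_m$. Put $N=\mu_1+\cdots+\mu_m$, $\mu(i)=(\mu_1,\dots,\mu_i)$ and $|\mu(i)|=\mu_1+\cdots+\mu_i$,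 and let $\lambda(i)=(\lambda(i)_1,\dots,\lambda(i)_i)$ be the shape of the tableau $\tau(i)$ obtained from $\tau$ by discarding all boxes with entry exceeding $i$. Regard $N\times N$ complex matrices as $\mu\times\mu$ block matrices. Let $J_{0,\mu}$ be the nilpotent matrix in (upper-triangular) Jordan form with blocks of sizes $\mu_1,\dots,\mu_m$. Let $\mathbb T_\mu$ be the affine space of the matrices $A=J_{0,\mu}+X$, where the only possibly nonzero entries of $X$ are the entries $A_{ij}^1,\dots,A_{ij}^{\min(\mu_i,\mu_j)}$ in the first $\min(\mu_i,\mu_j)$ columns of the last row of each $\mu_i\times\mu_j$ block; put $A_{ij}^k=0$ for $k>\min(\mu_i,\mu_j)$. Let $\mathfrak n$ be the set of strictly upper-triangular $N\times N$ matrices. For $A\in\mathbb T_\mu$ let $g(A)\in M_m(\mathbb C[t])$ be the matrix with entries $$g(A)_{ij}=\delta_{ij}t^{\mu_i}-\sum_{k=1}^{\mu_i}A_{ji}^k t^{k-1}.$$ The Mirković–Vybornov isomorphism is the map $A\mapsto g(A)\mathcal O^m$. Define $$\mathring X(\tau)=\{A\in\mathbb T_\mu\cap\mathfrak n:\ \text{for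 each } i=1,\dots,m \text{ the upper-left } |\mu(i)|\times|\mu(i)| \text{ submatrix of } A \text{ is nilpotent with Jordan blocks of sizes } \lambda(i)_1,\dots,\lambda(i)_i\},$$ $$\mathring Z(\tau)=\{L\in S^\mu_-:\ L_{[1,i]}\in\mathrm{Gr}^{\lambda(i)}\text{ for each } i=1,\dots,m\},$$ where $\mathrm{Gr}^{\lambda(i)}$ is taken in the affine Grassmannian of $GL_i$. Both are given their reduced structure of complex varieties, induced from the space of $N\times N$ matrices and from $\mathrm{Gr}$, respectively; here the lattices $L\subset\mathcal O^m$ with $\dim_{\mathbb C}\mathcal O^m/L=N$ form a closed subvariety of the Grassmannian of codimension $N$ subspaces of $\mathcal O^m/t^N\mathcal O^m$. Then the map $A\mapsto g(A)\mathcal O^m$ restricts to an isomorphism of varieties from $\mathring X(\tau)$ onto $\mathring Z(\tau)$. -/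

import Mathlib

open scoped PowerSeries LaurentSeries

noncomputable section

namespace MirkovicVybornov

/-! ### Zariski topology and regular functions

A complex variety is used in the classical sense: a set of points with coordinate charts. A subset of
it carries the induced (reduced) structure: induced topology, and regular functions that are locally
quotients of polynomials in the coordinates of a chart. -/

/-- A system of coordinate charts on a set of points: chart `i` has domain `dom i` and coordinate
functions `coord i · v`, `v : var i` (only their values on `dom i` are used). -/
structure Atlas (P : Type) where
  chart : Type
  var : chart → Type
  dom : chart → Set P
  coord : (i : chart) → P → var i → ℂ

/-- `V` is a relatively Zariski open subset of `Z`. -/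
def IsOpenIn {P : Type} (𝒜 : Atlas P) (Z V : Set P) : Prop :=
  V ⊆ Z ∧ ∀ p ∈ V, ∃ i, p ∈ 𝒜.dom i ∧ ∃ G : MvPolynomial (𝒜.var i) ℂ,
    MvPolynomial.eval (𝒜.coord i p) G ≠ 0 ∧
      ∀ q ∈ Z ∩ 𝒜.dom i, MvPolynomial.eval (𝒜.coord i q) G ≠ 0 → q ∈ V

/-- `φ` is a regular function on `V`: near each point of `V` it is a quotient of two polynomials in
the coordinates of a chart, with nonvanishing denominator. -/
def IsRegularOn {P : Type} (𝒜 : Atlas P) (V : Set P) (φ : P → ℂ) : Prop :=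
  ∀ p ∈ V, ∃ i, p ∈ 𝒜.dom i ∧ ∃ F G : MvPolynomial (𝒜.var i) ℂ,
    MvPolynomial.eval (𝒜.coord i p) G ≠ 0 ∧
      ∀ q ∈ V ∩ 𝒜.dom i, MvPolynomial.eval (𝒜.coord i q) G ≠ 0 →
        φ q = MvPolynomial.eval (𝒜.coord i q) F / MvPolynomial.eval (𝒜.coord i q) G

/-- `f` restricts to a morphism of varieties `X → Z`: it is continuous, and it pulls back regular
functions on open subsets to regular functions. -/
def IsMorphism {P Q : Type} (𝒜 : Atlas P) (ℬ : Atlas Q) (f : P → Q) (X : Set P) (Z : Set Q) : Prop :=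
  Set.MapsTo f X Z ∧ ∀ V, IsOpenIn ℬ Z V →
    IsOpenIn 𝒜 X (X ∩ f ⁻¹' V) ∧
      ∀ φ : Q → ℂ, IsRegularOn ℬ V φ → IsRegularOn 𝒜 (X ∩ f ⁻¹' V) (φ ∘ f)

/-- `f` maps `X` isomorphically onto `Z`: it is a morphism `X → Z` with a two-sided inverse morphism. -/
def MapsIsomorphically {P Q : Type} (𝒜 : Atlas P) (ℬ : Atlas Q) (f : P → Q) (X : Set P) (Z : Set Q) :
    Prop :=
  IsMorphism 𝒜 ℬ f X Z ∧ ∃ h : Q → P, IsMorphism ℬ 𝒜 h Z X ∧ Set.InvOn h f X Z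

/-- The affine space of complex `n × n` matrices: one global chart, the coordinates are the entries. -/
def matrixAtlas (n : Type) : Atlas (Matrix n n ℂ) where
  chart := Unit
  var _ := n × n
  dom _ := Set.univ
  coord _ A v := A v.1 v.2

/-! ### Lattices and the affine Grassmannian, `𝒪 = ℂ⟦X⟧`, `𝒦 = ℂ⸨X⸩` -/

/-- `𝒪`-submodules of `𝒦^m`. -/
abbrev LatticeSpace (m : ℕ) : Type := Submodule ℂ⟦X⟧ (Fin m → ℂ⸨X⸩)

/-- The standard lattice `𝒪^m`. -/
def stdLattice (m : ℕ) : LatticeSpace m :=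
  LinearMap.range ((Algebra.linearMap ℂ⟦X⟧ ℂ⸨X⸩).compLeft (Fin m))

/-- `g 𝒪^m`. -/
def latticeOf {m : ℕ} (g : Matrix (Fin m) (Fin m) ℂ⸨X⸩) : LatticeSpace m :=
  (stdLattice m).map ((Matrix.mulVecLin g).restrictScalars ℂ⟦X⟧)

/-- The affine Grassmannian `GL_m(𝒦) / GL_m(𝒪)` as the set of lattices `g 𝒪^m`. -/
def Gr (m : ℕ) : Set (LatticeSpace m) :=
  {L | ∃ g : GL (Fin m) ℂ⸨X⸩, L = latticeOf g.1}

/-- Its positive part: the lattices contained in `𝒪^m`. -/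
def GrPos (m : ℕ) : Set (LatticeSpace m) :=
  {L | L ∈ Gr m ∧ L ≤ stdLattice m}

/-- The vector `t^k e_j`. -/
def monomialVec {m : ℕ} (p : ℕ × Fin m) : Fin m → ℂ⸨X⸩ :=
  Pi.single p.2 (((PowerSeries.X : ℂ⟦X⟧) ^ p.1 : ℂ⟦X⟧) : ℂ⸨X⸩)

/-- `c` is a family of coefficients that expresses the class of `v` in `𝒪^m / L` through the classes
of the `t^k e_j`, `(k, j) ∈ I`. -/
def IsExpansion {m : ℕ} (I : Finset (ℕ × Fin m)) (L : LatticeSpace m) (v : Fin m → ℂ⸨X⸩)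
    (c : I → ℂ) : Prop :=
  v - ∑ p : I, c p • monomialVec p.1 ∈ L

/-- The variety structure of the positive part of the affine Grassmannian. A positive lattice `L` of
codimension `N` contains `t^N 𝒪^m`, so these lattices form a closed subvariety of the Grassmannian of
codimension `N` subspaces of `𝒪^m / t^N 𝒪^m`. The charts are the standard ones of that Grassmannian:
for a finite set `I` of monomials, the lattices for which `I` is a `ℂ`-basis of `𝒪^m / L`, with the
coefficients in this basis of the classes of all monomials `t^k e_j` as coordinates (the coordinates
with `k ≥ N` vanish). -/
def grAtlas (m : ℕ) : Atlas (LatticeSpace m) where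
  chart := Finset (ℕ × Fin m)
  var I := (ℕ × Fin m) × I
  dom I := {L | L ∈ GrPos m ∧ ∀ v ∈ stdLattice m, ∃! c : I → ℂ, IsExpansion I L v c}
  coord I L v := Classical.epsilon (IsExpansion I L (monomialVec v.1)) v.2

/-- `t^ν` as a matrix over `𝒪`. -/
def tPow {m : ℕ} (ν : Fin m → ℕ) : Matrix (Fin m) (Fin m) ℂ⟦X⟧ :=
  Matrix.diagonal fun i => PowerSeries.X ^ ν i

/-- View a matrix over `𝒪` as a matrix over `𝒦`. -/
def toLaurent {m : ℕ} (g : Matrix (Fin m) (Fin m) ℂ⟦X⟧) : Matrix (Fin m) (Fin m) ℂ⸨X⸩ :=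
  g.map (algebraMap ℂ⟦X⟧ ℂ⸨X⸩)

/-- The spherical Schubert cell `Gr^ν = GL_m(𝒪) t^ν`. -/
def schubertCell {m : ℕ} (ν : Fin m → ℕ) : Set (LatticeSpace m) :=
  {L | ∃ g : GL (Fin m) ℂ⟦X⟧, L = latticeOf (toLaurent (g.1 * tPow ν))}

/-- The semi-infinite orbit `S^ν_- = N_-(𝒦) t^ν`, with `N_-` the lower unitriangular group. -/
def semiInfiniteOrbit {m : ℕ} (ν : Fin m → ℕ) : Set (LatticeSpace m) :=
  {L | ∃ n : Matrix (Fin m) (Fin m) ℂ⸨X⸩,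
    (∀ i, n i i = 1) ∧ (∀ i j, i < j → n i j = 0) ∧ L = latticeOf (n * toLaurent (tPow ν))}

/-- `L_{[1,i]} = L / (L ∩ 𝒦^{[i+1,m]})`, i.e. the image of `L` under the projection to the first `i`
coordinates. -/
def truncate {m : ℕ} (i : ℕ) (hi : i ≤ m) (L : LatticeSpace m) : LatticeSpace i :=
  L.map ((LinearMap.funLeft ℂ⸨X⸩ ℂ⸨X⸩ (Fin.castLE hi)).restrictScalars ℂ⟦X⟧)

/-! ### Tableaux

The letters `1, …, m` of a tableau are represented by `0, …, m - 1`. -/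

/-- The number of boxes of `τ` with the `(i+1)`-st letter. -/
def weight {lam : YoungDiagram} (τ : SemistandardYoungTableau lam) (i : ℕ) : ℕ :=
  (lam.cells.filter fun c => τ c.1 c.2 = i).card

/-- The shape `λ(i)` of the tableau `τ(i)` that consists of the boxes of `τ` with one of the first `i`
letters, as a coweight of `GL_i`: its `j`-th entry is the number of such boxes in row `j`. -/
def subShape {lam : YoungDiagram} (τ : SemistandardYoungTableau lam) (i : ℕ) : Fin i → ℕ :=
  fun j => (lam.cells.filter fun c => c.1 = j.val ∧ τ c.1 c.2 < i).card

/-! ### Matrices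

The rows and columns of an `N × N` matrix, `N = |μ|`, are indexed by the pairs `(i, a)`,
`0 ≤ i < m`, `0 ≤ a < μ_i`, in lexicographic order: `a` is the position inside the `i`-th block. -/

/-- The index set of a `μ × μ` block matrix. -/
abbrev BlockIndex {m : ℕ} (μ : Fin m → ℕ) : Type := Σ i : Fin m, Fin (μ i)

/-- The nilpotent Jordan matrix with (upper triangular) blocks of sizes `μ_1, …, μ_m`. -/
def jordanMatrix {m : ℕ} (μ : Fin m → ℕ) : Matrix (BlockIndex μ) (BlockIndex μ) ℂ :=
  fun p q => if p.1 = q.1 ∧ q.2.val = p.2.val + 1 then 1 else 0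

/-- `A` is conjugate to the nilpotent Jordan matrix with blocks of sizes `ν_1, …, ν_k`. -/
def HasJordanType {n : Type} [Fintype n] [DecidableEq n] {k : ℕ} (A : Matrix n n ℂ)
    (ν : Fin k → ℕ) : Prop :=
  ∃ (e : n ≃ BlockIndex ν) (P : GL n ℂ),
    A = P.1 * (jordanMatrix ν).submatrix e e * (P⁻¹).1

/-- The slice `𝕋_μ`: a matrix in it agrees with the Jordan matrix except possibly in the first
`min(μ_i, μ_j)` columns of the last row of each `μ_i × μ_j` block. -/
def slice {m : ℕ} (μ : Fin m → ℕ) : Set (Matrix (BlockIndex μ) (BlockIndex μ) ℂ) :=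
  {A | ∀ p q, (p.2.val + 1 ≠ μ p.1 ∨ min (μ p.1) (μ q.1) ≤ q.2.val) → A p q = jordanMatrix μ p q}

/-- Strictly upper-triangular matrices. -/
def strictlyUpper {m : ℕ} (μ : Fin m → ℕ) : Set (Matrix (BlockIndex μ) (BlockIndex μ) ℂ) :=
  {A | ∀ p q, (q.1 < p.1 ∨ (q.1 = p.1 ∧ q.2.val ≤ p.2.val)) → A p q = 0}

/-- The polynomial `∑_k A_{ij}^k t^(k-1)` with the entries of the last row of the `(i, j)` block of
`A` as coefficients (zero if the block has no rows). -/
def lastRowPoly {m : ℕ} {μ : Fin m → ℕ} (A : Matrix (BlockIndex μ) (BlockIndex μ) ℂ) (i j : Fin m) :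
    Polynomial ℂ :=
  if h : 0 < μ i then
    ∑ k : Fin (μ j), Polynomial.C (A ⟨i, ⟨μ i - 1, Nat.sub_lt h one_pos⟩⟩ ⟨j, k⟩) * Polynomial.X ^ k.val
  else 0

/-- The matrix of polynomials `g(A)`; the `(j, i)` block of `A` gives the `(i, j)` entry. -/
def gPoly {m : ℕ} {μ : Fin m → ℕ} (A : Matrix (BlockIndex μ) (BlockIndex μ) ℂ) :
    Matrix (Fin m) (Fin m) (Polynomial ℂ) :=
  fun i j => (if i = j then Polynomial.X ^ μ i else 0) - lastRowPoly A j i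

/-- The Mirković–Vybornov map `A ↦ g(A) 𝒪^m`. -/
def mvMap {m : ℕ} (μ : Fin m → ℕ) (A : Matrix (BlockIndex μ) (BlockIndex μ) ℂ) : LatticeSpace m :=
  latticeOf (toLaurent ((gPoly A).map fun f => (f : ℂ⟦X⟧)))

/-- The upper left submatrix of size `|μ(i)| = μ_1 + ⋯ + μ_i`, that is, the first `i` blocks. -/
def leadingSubmatrix {m : ℕ} {μ : Fin m → ℕ} (i : ℕ) (A : Matrix (BlockIndex μ) (BlockIndex μ) ℂ) :
    Matrix {p : BlockIndex μ // p.1.val < i} {p : BlockIndex μ // p.1.val < i} ℂ :=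
  A.submatrix Subtype.val Subtype.val

/-- `X̊(τ)`. -/
def openX {m : ℕ} (μ : Fin m → ℕ) {lam : YoungDiagram} (τ : SemistandardYoungTableau lam) :
    Set (Matrix (BlockIndex μ) (BlockIndex μ) ℂ) :=
  {A | A ∈ slice μ ∧ A ∈ strictlyUpper μ ∧
    ∀ i, 1 ≤ i → i ≤ m → HasJordanType (leadingSubmatrix i A) (subShape τ i)}

/-- `Z̊(τ)`. -/
def openZ {m : ℕ} (μ : Fin m → ℕ) {lam : YoungDiagram} (τ : SemistandardYoungTableau lam) :
    Set (LatticeSpace m) :=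
  {L | L ∈ semiInfiniteOrbit μ ∧
    ∀ i, 1 ≤ i → ∀ hi : i ≤ m, truncate i hi L ∈ schubertCell (subShape τ i)}

end MirkovicVybornov

end

open MirkovicVybornov

noncomputable section

namespace MirkovicVybornov

/-! ### A chartwise criterion for morphisms -/

/-! For strictly upper-triangular `A` the matrix g(A) is lower triangular with diagonal t^{μ_i}, so
division with remainder makes the monomials t^a e_i, a < μ_i, a ℂ-basis of 𝒪^m / g(A)𝒪^m
(`quotientEquiv`). The columns of g(A) are the relations that express t^{μ_i} e_i through the last
row of the i-th block row, hence t acts on this basis by c ↦ cA on row vectors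
(`X_smul_blockVec_sub_mem`).

Thus the Jordan type of `A` is the type of the torsion module 𝒪^m / L, which is what Schubert cells
record (`mvMap_mem_schubertCell_iff`). Projecting a lower-triangular lattice to the first i
coordinates keeps the upper-left corner of g(A), so the same argument applies to every leading
submatrix, and `mvMap_mem_openZ_iff` matches the two sets of conditions.

Every lattice in Z̊(τ) is integral, and reducing each t^{μ_j} e_j modulo it yields the required `A`
(`exists_eq_mvMap`); dominance of μ puts `A` in the slice. The matrix is recovered from the
coordinates of these classes (`mvInv_mvMap`), so the inverse is polynomial in one chart. In any
chart, the coordinates of g(A)𝒪^m are fractions by Cramer's rule applied to rows of powers of `A`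
(`isMorphism_mvMap`). -/

/-- After substituting fractions with the common denominator `D`, a polynomial becomes a fraction
whose denominator is a power of `D`. -/
theorem exists_eval_div_eq {σ υ : Type} (D : MvPolynomial υ ℂ) (F : σ → MvPolynomial υ ℂ)
    (G : MvPolynomial σ ℂ) :
    ∃ (H : MvPolynomial υ ℂ) (n : ℕ), ∀ x : υ → ℂ, MvPolynomial.eval x D ≠ 0 →
      MvPolynomial.eval (fun v => MvPolynomial.eval x (F v) / MvPolynomial.eval x D) G =
        MvPolynomial.eval x H / MvPolynomial.eval x D ^ n := by
  induction G using MvPolynomial.induction_on with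
  | C a => exact ⟨MvPolynomial.C a, 0, fun x _ => by simp⟩
  | add p q hp hq =>
    obtain ⟨H₁, n₁, h₁⟩ := hp
    obtain ⟨H₂, n₂, h₂⟩ := hq
    refine ⟨H₁ * D ^ n₂ + H₂ * D ^ n₁, n₁ + n₂, fun x hx => ?_⟩
    simp only [map_add, map_mul, map_pow, h₁ x hx, h₂ x hx]
    field_simp
    ring
  | mul_X p i hp =>
    obtain ⟨H, n, h⟩ := hp
    refine ⟨H * F i, n + 1, fun x hx => ?_⟩
    simp only [map_mul, MvPolynomial.eval_X, h x hx]
    field_simp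
    ring

/-- A map is a morphism if near each point it is given, in the charts of the target, by fractions of
polynomials with a common denominator. -/
theorem isMorphism_of_charts {P Q : Type} {𝒜 : Atlas P} {ℬ : Atlas Q} {f : P → Q} {X : Set P}
    {Z : Set Q} (hXZ : Set.MapsTo f X Z)
    (hf : ∀ p ∈ X, ∀ i, f p ∈ ℬ.dom i → ∃ j, p ∈ 𝒜.dom j ∧
      ∃ (D : MvPolynomial (𝒜.var j) ℂ) (F : ℬ.var i → MvPolynomial (𝒜.var j) ℂ),
        MvPolynomial.eval (𝒜.coord j p) D ≠ 0 ∧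
          ∀ q ∈ X ∩ 𝒜.dom j, MvPolynomial.eval (𝒜.coord j q) D ≠ 0 →
            f q ∈ ℬ.dom i ∧ ∀ v, ℬ.coord i (f q) v =
              MvPolynomial.eval (𝒜.coord j q) (F v) / MvPolynomial.eval (𝒜.coord j q) D) :
    IsMorphism 𝒜 ℬ f X Z := by
  refine ⟨hXZ, fun V hV => ⟨⟨Set.inter_subset_left, fun p hp => ?_⟩, fun φ hφ p hp => ?_⟩⟩
  · obtain ⟨i, hi, G, hG, hGV⟩ := hV.2 (f p) hp.2
    obtain ⟨j, hj, D, F, hD, hDF⟩ := hf p hp.1 i hi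
    obtain ⟨H, n, hH⟩ := exists_eval_div_eq D F G
    have key : ∀ q ∈ X ∩ 𝒜.dom j, MvPolynomial.eval (𝒜.coord j q) D ≠ 0 →
        MvPolynomial.eval (ℬ.coord i (f q)) G =
          MvPolynomial.eval (𝒜.coord j q) H / MvPolynomial.eval (𝒜.coord j q) D ^ n := by
      intro q hq hqD
      rw [← hH _ hqD, funext (hDF q hq hqD).2]
    -- The factor `D` keeps the new open set inside the locus where the fractions are defined.
    refine ⟨j, hj, H * D, ?_, fun q hq hne => ?_⟩
    · rw [key p ⟨hp.1, hj⟩ hD] at hG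
      simp only [map_mul]
      exact mul_ne_zero (fun h => hG (by simp [h])) hD
    · simp only [map_mul] at hne
      have hqD := right_ne_zero_of_mul hne
      refine ⟨hq.1, hGV _ ⟨hXZ hq.1, (hDF q hq hqD).1⟩ ?_⟩
      rw [key q hq hqD]
      exact div_ne_zero (left_ne_zero_of_mul hne) (pow_ne_zero _ hqD)
  · obtain ⟨i, hi, F₀, G, hG, hφG⟩ := hφ (f p) hp.2
    obtain ⟨j, hj, D, F, hD, hDF⟩ := hf p hp.1 i hi
    obtain ⟨H, n, hH⟩ := exists_eval_div_eq D F G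
    obtain ⟨K, k, hK⟩ := exists_eval_div_eq D F F₀
    have key : ∀ q ∈ X ∩ 𝒜.dom j, MvPolynomial.eval (𝒜.coord j q) D ≠ 0 →
        MvPolynomial.eval (ℬ.coord i (f q)) G =
          MvPolynomial.eval (𝒜.coord j q) H / MvPolynomial.eval (𝒜.coord j q) D ^ n := by
      intro q hq hqD
      rw [← hH _ hqD, funext (hDF q hq hqD).2]
    have key' : ∀ q ∈ X ∩ 𝒜.dom j, MvPolynomial.eval (𝒜.coord j q) D ≠ 0 →
        MvPolynomial.eval (ℬ.coord i (f q)) F₀ =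
          MvPolynomial.eval (𝒜.coord j q) K / MvPolynomial.eval (𝒜.coord j q) D ^ k := by
      intro q hq hqD
      rw [← hK _ hqD, funext (hDF q hq hqD).2]
    -- This is (K / D^k) / (H / D^n), with one spare `D` above and below so that a nonzero
    -- denominator forces `D` ≠ 0 even when k = 0.
    refine ⟨j, hj, K * D ^ (n + 1), H * D ^ (k + 1), ?_, fun q hq hne => ?_⟩
    · rw [key p ⟨hp.1, hj⟩ hD] at hG
      simp only [map_mul, map_pow]
      exact mul_ne_zero (fun h => hG (by simp [h])) (pow_ne_zero _ hD)
    · simp only [map_mul, map_pow] at hne ⊢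
      have hqX : q ∈ X ∩ 𝒜.dom j := ⟨hq.1.1, hq.2⟩
      have hqH := left_ne_zero_of_mul hne
      have hqD : MvPolynomial.eval (𝒜.coord j q) D ≠ 0 :=
        fun h => right_ne_zero_of_mul hne (by simp [h])
      rw [Function.comp_apply, hφG (f q) ⟨hq.1.2, (hDF q hqX hqD).1⟩ ?_, key q hqX hqD,
        key' q hqX hqD]
      · field_simp
        ring
      · rw [key q hqX hqD]
        exact div_ne_zero hqH (pow_ne_zero _ hqD)

/-! ### Lattices inside `𝒪^m` -/

/-- The column lattice `g 𝒪^m` of a matrix over `𝒪`, as a submodule of `𝒪^m`. -/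
def colLattice {m : ℕ} (g : Matrix (Fin m) (Fin m) ℂ⟦X⟧) : Submodule ℂ⟦X⟧ (Fin m → ℂ⟦X⟧) :=
  LinearMap.range g.mulVecLin

/-- The inclusion `𝒪^m → 𝒦^m`. -/
def incl (m : ℕ) : (Fin m → ℂ⟦X⟧) →ₗ[ℂ⟦X⟧] (Fin m → ℂ⸨X⸩) :=
  (Algebra.linearMap ℂ⟦X⟧ ℂ⸨X⸩).compLeft (Fin m)

theorem incl_apply {m : ℕ} (v : Fin m → ℂ⟦X⟧) (i : Fin m) : incl m v i = algebraMap ℂ⟦X⟧ ℂ⸨X⸩ (v i) :=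
  rfl

theorem algebraMap_laurent_injective : Function.Injective (algebraMap ℂ⟦X⟧ ℂ⸨X⸩) :=
  FaithfulSMul.algebraMap_injective _ _

theorem incl_injective (m : ℕ) : Function.Injective (incl m) := fun _ _ h =>
  funext fun i => algebraMap_laurent_injective (congrFun h i)

theorem incl_smul {m : ℕ} (c : ℂ) (v : Fin m → ℂ⟦X⟧) : incl m (c • v) = c • incl m v := by
  funext i
  simp only [incl_apply, Pi.smul_apply]
  rw [PowerSeries.smul_eq_C_mul, map_mul, ← HahnSeries.C_mul_eq_smul]
  congr 1
  exact HahnSeries.ofPowerSeries_C c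

theorem stdLattice_eq (m : ℕ) : stdLattice m = LinearMap.range (incl m) := rfl

theorem incl_mulVec {m : ℕ} (g : Matrix (Fin m) (Fin m) ℂ⟦X⟧) (v : Fin m → ℂ⟦X⟧) :
    incl m (g.mulVec v) = (toLaurent g).mulVec (incl m v) := by
  funext i
  simp [incl_apply, toLaurent, Matrix.mulVec, dotProduct]

theorem latticeOf_toLaurent {m : ℕ} (g : Matrix (Fin m) (Fin m) ℂ⟦X⟧) :
    latticeOf (toLaurent g) = (colLattice g).map (incl m) := by
  ext v
  simp only [latticeOf, stdLattice_eq, colLattice, Submodule.mem_map, LinearMap.mem_range]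
  constructor
  · rintro ⟨_, ⟨w, rfl⟩, rfl⟩
    exact ⟨_, ⟨w, rfl⟩, incl_mulVec g w⟩
  · rintro ⟨_, ⟨w, rfl⟩, rfl⟩
    exact ⟨_, ⟨w, rfl⟩, (incl_mulVec g w).symm⟩

theorem latticeOf_toLaurent_le {m : ℕ} (g : Matrix (Fin m) (Fin m) ℂ⟦X⟧) :
    latticeOf (toLaurent g) ≤ stdLattice m := by
  rw [latticeOf_toLaurent, stdLattice_eq]
  exact LinearMap.map_le_range

theorem latticeOf_toLaurent_inj {m : ℕ} {g h : Matrix (Fin m) (Fin m) ℂ⟦X⟧} :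
    latticeOf (toLaurent g) = latticeOf (toLaurent h) ↔ colLattice g = colLattice h := by
  rw [latticeOf_toLaurent, latticeOf_toLaurent]
  exact (Submodule.map_injective_of_injective (incl_injective m)).eq_iff

theorem col_mem_colLattice {m : ℕ} (g : Matrix (Fin m) (Fin m) ℂ⟦X⟧) (j : Fin m) :
    g.col j ∈ colLattice g :=
  ⟨Pi.single j 1, by simp⟩

theorem colLattice_le_iff {m : ℕ} {g : Matrix (Fin m) (Fin m) ℂ⟦X⟧}
    {L : Submodule ℂ⟦X⟧ (Fin m → ℂ⟦X⟧)} : colLattice g ≤ L ↔ ∀ j, g.col j ∈ L := by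
  rw [colLattice, Matrix.range_mulVecLin, Submodule.span_le]
  exact Set.range_subset_iff

theorem colLattice_eq_span {m : ℕ} (g : Matrix (Fin m) (Fin m) ℂ⟦X⟧) :
    colLattice g = Submodule.span ℂ⟦X⟧ (Set.range g.col) :=
  Matrix.range_mulVecLin g

/-! ### Monomial representatives modulo a triangular lattice -/

/-- The vector of polynomials with coefficients `c`: the `i`-th one has degree less than `μ_i`. -/
def blockVec {m : ℕ} (μ : Fin m → ℕ) : (BlockIndex μ → ℂ) →ₗ[ℂ] (Fin m → ℂ⟦X⟧) where
  toFun c i := PowerSeries.mk fun k => if h : k < μ i then c ⟨i, k, h⟩ else 0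
  map_add' c d := by
    funext i; ext k
    by_cases h : k < μ i <;> simp [h]
  map_smul' a c := by
    funext i; ext k
    by_cases h : k < μ i <;> simp [h]

theorem coeff_blockVec {m : ℕ} (μ : Fin m → ℕ) (c : BlockIndex μ → ℂ) (i : Fin m) (k : ℕ) :
    PowerSeries.coeff k (blockVec μ c i) = if h : k < μ i then c ⟨i, k, h⟩ else 0 := by
  simp [blockVec]

theorem blockVec_single {m : ℕ} (μ : Fin m → ℕ) (p : BlockIndex μ) :
    blockVec μ (Pi.single p 1) = Pi.single p.1 (PowerSeries.X ^ p.2.val) := by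
  obtain ⟨j, a, ha⟩ := p
  funext i; ext k
  rw [coeff_blockVec]
  rcases eq_or_ne i j with rfl | hij
  · rw [Pi.single_eq_same, PowerSeries.coeff_X_pow]
    by_cases hk : k = a
    · subst hk; simp [ha]
    · simp [hk, Sigma.ext_iff, Fin.ext_iff]
  · simp [hij, Sigma.ext_iff]

theorem blockVec_injective {m : ℕ} (μ : Fin m → ℕ) : Function.Injective (blockVec μ) := by
  intro c d h
  funext ⟨i, a, ha⟩
  have := congrArg (PowerSeries.coeff a) (congrFun h i)
  simpa [coeff_blockVec, ha] using this

theorem blockVec_eq_zero_of {m : ℕ} {μ : Fin m → ℕ} {c : BlockIndex μ → ℂ} {i : Fin m}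
    (h : ∀ a, c ⟨i, a⟩ = 0) : blockVec μ c i = 0 := by
  ext k
  simp [coeff_blockVec, h]

/-- `g` is lower triangular with diagonal entries `t^{μ_i}`. -/
structure IsTriangular {m : ℕ} (μ : Fin m → ℕ) (g : Matrix (Fin m) (Fin m) ℂ⟦X⟧) : Prop where
  diag : ∀ i, g i i = PowerSeries.X ^ μ i
  upper : ∀ i j, i < j → g i j = 0

/-- Divide the first possibly nonzero coordinate by t^{μ_J}: the quotient `w` times column J removes
all but the remainder `c₀`, and lower triangularity leaves earlier coordinates untouched. The
control on the support of `c` is what later makes the reduced matrix strictly upper triangular. -/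
theorem IsTriangular.exists_blockVec_sub_mem_of_lt {m : ℕ} {μ : Fin m → ℕ}
    {g : Matrix (Fin m) (Fin m) ℂ⟦X⟧} (hg : IsTriangular μ g) (d j : ℕ) (hj : j + d = m)
    (v : Fin m → ℂ⟦X⟧) (hv : ∀ i : Fin m, i.val < j → v i = 0) :
    ∃ c : BlockIndex μ → ℂ, (∀ p, p.1.val < j → c p = 0) ∧ v - blockVec μ c ∈ colLattice g := by
  induction d generalizing j v with
  | zero =>
    refine ⟨0, fun _ _ => rfl, ?_⟩
    have : v = 0 := funext fun i => hv i (by have := i.2; lia)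
    simp [this]
  | succ d ih =>
    let J : Fin m := ⟨j, by lia⟩
    let w : ℂ⟦X⟧ := PowerSeries.mk fun k => PowerSeries.coeff (k + μ J) (v J)
    let c₀ : BlockIndex μ → ℂ := fun p => if p.1 = J then PowerSeries.coeff p.2.val (v J) else 0
    obtain ⟨c, hc, hmem⟩ := ih (j + 1) (by lia) (v - w • g.col J - blockVec μ c₀) (by
      intro i hi
      rcases eq_or_ne i J with rfl | hiJ
      · ext k
        simp only [Pi.sub_apply, Pi.smul_apply, Matrix.col_apply, hg.diag, smul_eq_mul, map_sub,
          coeff_blockVec, PowerSeries.coeff_mul_X_pow', w, c₀]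
        by_cases hk : k < μ J
        · simp [hk, not_le.2 hk]
        · simp [hk, not_lt.1 hk]
      · have hlt : i.val < j := by
          have : i.val ≠ j := fun h => hiJ (Fin.ext h)
          lia
        have h1 : blockVec μ c₀ i = 0 := blockVec_eq_zero_of fun a => by simp [c₀, hiJ]
        simp [hv i hlt, hg.upper i J hlt, h1])
    refine ⟨c + c₀, fun p hp => ?_, ?_⟩
    · have : p.1 ≠ J := fun h => by simp [h, J] at hp
      simp [hc p (by lia), c₀, this]
    · have := add_mem hmem ((colLattice g).smul_mem w (col_mem_colLattice g J))
      rw [map_add]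
      convert this using 1
      abel

theorem IsTriangular.exists_blockVec_sub_mem {m : ℕ} {μ : Fin m → ℕ}
    {g : Matrix (Fin m) (Fin m) ℂ⟦X⟧} (hg : IsTriangular μ g) (v : Fin m → ℂ⟦X⟧) :
    ∃ c : BlockIndex μ → ℂ, v - blockVec μ c ∈ colLattice g := by
  obtain ⟨c, -, hc⟩ := hg.exists_blockVec_sub_mem_of_lt m 0 (zero_add m) v (by simp)
  exact ⟨c, hc⟩

/-- Once the earlier `a` vanish, coordinate i equates t^{μ_i} a_i with a polynomial of degree below
μ_i, so a_i = 0. -/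
theorem IsTriangular.eq_zero_of_blockVec_mem {m : ℕ} {μ : Fin m → ℕ}
    {g : Matrix (Fin m) (Fin m) ℂ⟦X⟧} (hg : IsTriangular μ g) {c : BlockIndex μ → ℂ}
    (hc : blockVec μ c ∈ colLattice g) : c = 0 := by
  obtain ⟨a, ha⟩ := hc
  have key : ∀ n : ℕ, ∀ i : Fin m, i.val = n → a i = 0 := by
    intro n
    induction n using Nat.strong_induction_on with
    | _ n ih =>
      intro i hi
      have h := congrFun ha i
      rw [Matrix.mulVecLin_apply, Matrix.mulVec, dotProduct, Finset.sum_eq_single i, hg.diag] at h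
      · ext k
        have := congrArg (PowerSeries.coeff (k + μ i)) h
        rwa [PowerSeries.coeff_X_pow_mul, coeff_blockVec, dif_neg (by lia)] at this
      · intro b _ hb
        rcases lt_or_gt_of_ne hb with h' | h'
        · rw [ih b.val (by rw [← hi]; exact h') b rfl, mul_zero]
        · rw [hg.upper i b h', zero_mul]
      · simp
  have ha0 : a = 0 := funext fun i => key _ i rfl
  rw [ha0, map_zero] at ha
  exact blockVec_injective μ (by rw [← ha, map_zero])

/-- The monomials `t^a e_i`, `a < μ_i`, form a basis of `𝒪^m / L`. -/
def quotientEquiv {m : ℕ} {μ : Fin m → ℕ} {g : Matrix (Fin m) (Fin m) ℂ⟦X⟧}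
    (hg : IsTriangular μ g) : (BlockIndex μ → ℂ) ≃ₗ[ℂ] ((Fin m → ℂ⟦X⟧) ⧸ colLattice g) :=
  LinearEquiv.ofBijective (((colLattice g).mkQ.restrictScalars ℂ) ∘ₗ blockVec μ) (by
    constructor
    · rw [← LinearMap.ker_eq_bot, LinearMap.ker_eq_bot']
      intro c hc
      exact hg.eq_zero_of_blockVec_mem ((Submodule.Quotient.mk_eq_zero _).1 hc)
    · intro x
      obtain ⟨v, rfl⟩ := Submodule.mkQ_surjective _ x
      obtain ⟨c, hc⟩ := hg.exists_blockVec_sub_mem v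
      exact ⟨c, ((Submodule.Quotient.eq _).2 hc).symm⟩)

theorem quotientEquiv_apply {m : ℕ} {μ : Fin m → ℕ} {g : Matrix (Fin m) (Fin m) ℂ⟦X⟧}
    (hg : IsTriangular μ g) (c : BlockIndex μ → ℂ) :
    quotientEquiv hg c = (colLattice g).mkQ (blockVec μ c) := rfl

/-- Both quotients have the same monomial basis, so neither lattice can be strictly smaller. -/
theorem IsTriangular.colLattice_eq_of_le {m : ℕ} {μ : Fin m → ℕ}
    {g h : Matrix (Fin m) (Fin m) ℂ⟦X⟧} (hg : IsTriangular μ g) (hh : IsTriangular μ h)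
    (hle : colLattice g ≤ colLattice h) : colLattice g = colLattice h := by
  refine le_antisymm hle fun v hv => ?_
  obtain ⟨c, hc⟩ := hg.exists_blockVec_sub_mem v
  have : blockVec μ c ∈ colLattice h := by
    simpa using sub_mem hv (hle hc)
  rw [hh.eq_zero_of_blockVec_mem this] at hc
  simpa using hc

/-! ### The matrix `g(A)` -/

/-- `g(A)` as a matrix of power series. -/
def gSeries {m : ℕ} {μ : Fin m → ℕ} (A : Matrix (BlockIndex μ) (BlockIndex μ) ℂ) :
    Matrix (Fin m) (Fin m) ℂ⟦X⟧ :=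
  (gPoly A).map fun f => (f : ℂ⟦X⟧)

theorem mvMap_eq {m : ℕ} (μ : Fin m → ℕ) (A : Matrix (BlockIndex μ) (BlockIndex μ) ℂ) :
    mvMap μ A = latticeOf (toLaurent (gSeries A)) := rfl

theorem lastRowPoly_coe {m : ℕ} {μ : Fin m → ℕ} (A : Matrix (BlockIndex μ) (BlockIndex μ) ℂ)
    {i : Fin m} (h : 0 < μ i) (j : Fin m) :
    (lastRowPoly A i j : ℂ⟦X⟧) = blockVec μ (A ⟨i, μ i - 1, Nat.sub_lt h one_pos⟩) j := by
  ext k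
  rw [Polynomial.coeff_coe, coeff_blockVec, lastRowPoly, dif_pos h, Polynomial.finsetSum_coeff]
  simp only [Polynomial.coeff_C_mul_X_pow]
  by_cases hk : k < μ j
  · rw [Finset.sum_eq_single ⟨k, hk⟩]
    · simp [hk]
    · intro b _ hb
      rw [if_neg]
      rintro rfl
      exact hb rfl
    · simp
  · rw [dif_neg hk]
    refine Finset.sum_eq_zero fun b _ => if_neg ?_
    rintro rfl
    exact hk b.2

theorem gSeries_apply {m : ℕ} {μ : Fin m → ℕ} (A : Matrix (BlockIndex μ) (BlockIndex μ) ℂ)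
    (i j : Fin m) :
    gSeries A i j = (if i = j then PowerSeries.X ^ μ i else 0) - (lastRowPoly A j i : ℂ⟦X⟧) := by
  simp only [gSeries, gPoly, Matrix.map_apply, Polynomial.coe_sub]
  split_ifs <;> simp

theorem gSeries_col {m : ℕ} {μ : Fin m → ℕ} (A : Matrix (BlockIndex μ) (BlockIndex μ) ℂ)
    {j : Fin m} (h : 0 < μ j) :
    (gSeries A).col j =
      Pi.single j (PowerSeries.X ^ μ j) - blockVec μ (A ⟨j, μ j - 1, Nat.sub_lt h one_pos⟩) := by
  funext i
  rw [Matrix.col_apply, gSeries_apply, lastRowPoly_coe A h, Pi.sub_apply, Pi.single_apply]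
  congr 1
  split_ifs with hij
  · rw [hij]
  · rfl

theorem gSeries_col_of_eq_zero {m : ℕ} {μ : Fin m → ℕ}
    (A : Matrix (BlockIndex μ) (BlockIndex μ) ℂ) {j : Fin m} (h : μ j = 0) :
    (gSeries A).col j = Pi.single j 1 := by
  funext i
  rw [Matrix.col_apply, gSeries_apply, lastRowPoly, dif_neg (by lia), Pi.single_apply]
  split_ifs with hij <;> simp [hij, h]

/-- The transposition of block indices in g(A) turns upper into lower triangular. In a diagonal
block the last row lies on or below the diagonal, hence vanishes. -/
theorem isTriangular_gSeries {m : ℕ} {μ : Fin m → ℕ} {A : Matrix (BlockIndex μ) (BlockIndex μ) ℂ}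
    (hA : A ∈ strictlyUpper μ) : IsTriangular μ (gSeries A) := by
  have key : ∀ i j : Fin m, i ≤ j → (gSeries A) i j = if i = j then PowerSeries.X ^ μ i else 0 := by
    intro i j hij
    rcases Nat.eq_zero_or_pos (μ j) with h | h
    · rw [gSeries_apply, lastRowPoly, dif_neg (by lia)]
      simp
    · rw [gSeries_apply, lastRowPoly_coe A h, blockVec_eq_zero_of, sub_zero]
      intro a
      refine hA _ _ ?_
      rcases hij.lt_or_eq with h' | rfl
      · exact Or.inl h'
      · exact Or.inr ⟨rfl, by have := a.2; simp only; lia⟩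
  exact ⟨fun i => by simp [key i i le_rfl], fun i j hij => by simp [key i j hij.le, hij.ne]⟩

/-- The rows of `A` except the last ones of the blocks agree with those of the Jordan matrix. -/
def IsJordanLike {m : ℕ} {μ : Fin m → ℕ} (A : Matrix (BlockIndex μ) (BlockIndex μ) ℂ) : Prop :=
  ∀ p q, p.2.val + 1 ≠ μ p.1 → A p q = jordanMatrix μ p q

theorem isJordanLike_of_mem_slice {m : ℕ} {μ : Fin m → ℕ}
    {A : Matrix (BlockIndex μ) (BlockIndex μ) ℂ} (hA : A ∈ slice μ) : IsJordanLike A :=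
  fun p q h => hA p q (Or.inl h)

theorem jordanMatrix_mem_strictlyUpper {m : ℕ} (ν : Fin m → ℕ) :
    jordanMatrix ν ∈ strictlyUpper ν := by
  intro p q h
  refine if_neg ?_
  rintro ⟨h1, h2⟩
  rcases h with h | h
  · exact h.ne h1.symm
  · lia

/-- This lets t^ν 𝒪^m be handled as the lattice of a matrix, on the same footing as g(A)𝒪^m. -/
theorem gSeries_jordanMatrix {m : ℕ} (ν : Fin m → ℕ) : gSeries (jordanMatrix ν) = tPow ν := by
  ext1 i j
  have h0 : (lastRowPoly (jordanMatrix ν) j i : ℂ⟦X⟧) = 0 := by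
    rcases Nat.eq_zero_or_pos (ν j) with h | h
    · rw [lastRowPoly, dif_neg (by lia)]
      simp
    · rw [lastRowPoly_coe _ h]
      refine blockVec_eq_zero_of fun a => if_neg ?_
      rintro ⟨rfl, h2⟩
      have := a.2
      simp only at h2
      lia
  rw [gSeries_apply, h0, tPow, Matrix.diagonal_apply, sub_zero]

/-- Modulo `g(A) 𝒪^m`, multiplication by `t` acts on the monomial basis by the rows of `A`. -/
theorem X_smul_blockVec_sub_mem {m : ℕ} {μ : Fin m → ℕ}
    {A : Matrix (BlockIndex μ) (BlockIndex μ) ℂ} (hA : IsJordanLike A) (c : BlockIndex μ → ℂ) :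
    (PowerSeries.X : ℂ⟦X⟧) • blockVec μ c - blockVec μ (Matrix.vecMul c A) ∈
      colLattice (gSeries A) := by
  have hsingle : ∀ p : BlockIndex μ, (PowerSeries.X : ℂ⟦X⟧) • blockVec μ (Pi.single p 1) -
      blockVec μ (A p) ∈ colLattice (gSeries A) := by
    intro p
    rw [blockVec_single, ← Pi.single_smul, smul_eq_mul, ← pow_succ']
    -- In a last row the relation is a column of g(A); in any other row `A` is a plain shift and the
    -- difference is zero.
    by_cases hp : p.2.val + 1 = μ p.1
    · have h0 : 0 < μ p.1 := by lia
      have hp' : p = ⟨p.1, μ p.1 - 1, Nat.sub_lt h0 one_pos⟩ := by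
        obtain ⟨i, a, ha⟩ := p
        simp only at hp
        simp only [Sigma.mk.injEq, heq_eq_eq, Fin.mk.injEq, true_and]
        lia
      have := col_mem_colLattice (gSeries A) p.1
      rwa [gSeries_col A h0, ← hp', ← hp] at this
    · have h1 : p.2.val + 1 < μ p.1 := by have := p.2.2; lia
      have : A p = Pi.single (⟨p.1, p.2.val + 1, h1⟩ : BlockIndex μ) 1 := by
        funext q
        rw [hA p q hp, jordanMatrix, Pi.single_apply]
        congr 1
        obtain ⟨i, a, ha⟩ := p
        obtain ⟨j, b, hb⟩ := q
        simp only [Sigma.mk.injEq, eq_iff_iff]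
        constructor
        · rintro ⟨rfl, rfl⟩; simp
        · rintro ⟨rfl, h⟩; simpa using h
      rw [this, blockVec_single]
      simp
  induction c using Pi.single_induction with
  | zero => simp
  | add f g hf hg =>
    rw [Matrix.add_vecMul, map_add, map_add, smul_add]
    convert add_mem hf hg using 1
    abel
  | single p a =>
    have h1 : (Pi.single p a : BlockIndex μ → ℂ) = a • Pi.single p 1 := by
      rw [← Pi.single_smul, smul_eq_mul, mul_one]
    rw [h1, Matrix.smul_vecMul, Matrix.single_one_vecMul, map_smul, map_smul, smul_comm, ← smul_sub]
    exact ((colLattice (gSeries A)).restrictScalars ℂ).smul_mem a (hsingle p)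

/-! ### Jordan types -/

/-- Conjugacy as an intertwiner of the actions on row vectors, the form in which isomorphisms of
quotient modules supply it. The bijection of index sets comes from comparing dimensions. -/
theorem hasJordanType_iff {n : Type} [Fintype n] [DecidableEq n] {k : ℕ} (A : Matrix n n ℂ)
    (ν : Fin k → ℕ) :
    HasJordanType A ν ↔ ∃ T : (n → ℂ) ≃ₗ[ℂ] (BlockIndex ν → ℂ),
      ∀ c, T (Matrix.vecMul c A) = Matrix.vecMul (T c) (jordanMatrix ν) := by
  constructor
  · rintro ⟨e, P, hA⟩
    have hAP : A * P.1 = P.1 * (jordanMatrix ν).submatrix e e := by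
      rw [hA, Matrix.mul_assoc, ← Units.val_mul, inv_mul_cancel, Units.val_one, Matrix.mul_one]
    refine ⟨Matrix.toLinearEquivRight'OfInv P.inv_val P.val_inv ≪≫ₗ
      LinearEquiv.funCongrLeft ℂ ℂ e.symm, fun c => ?_⟩
    change (Matrix.vecMul (Matrix.vecMul c A) P.1) ∘ e.symm =
      Matrix.vecMul ((Matrix.vecMul c P.1) ∘ e.symm) (jordanMatrix ν)
    rw [Matrix.vecMul_vecMul, hAP, ← Matrix.vecMul_vecMul, Matrix.submatrix_vecMul_equiv]
    funext q
    simp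
  · rintro ⟨T, hT⟩
    have hcard : Fintype.card n = Fintype.card (BlockIndex ν) := by
      simpa only [Module.finrank_fintype_fun_eq_card] using T.finrank_eq
    let e : n ≃ BlockIndex ν := Fintype.equivOfCardEq hcard
    let S : (n → ℂ) ≃ₗ[ℂ] (n → ℂ) := T ≪≫ₗ LinearEquiv.funCongrLeft ℂ ℂ e
    have hS : ∀ c, S (Matrix.vecMul c A) =
        Matrix.vecMul (S c) ((jordanMatrix ν).submatrix e e) := by
      intro c
      change T (Matrix.vecMul c A) ∘ e = Matrix.vecMul (T c ∘ e) _
      rw [hT, Matrix.submatrix_vecMul_equiv]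
      congr 2
      funext q
      simp
    let M := LinearMap.toMatrixRight' S.toLinearMap
    let M' := LinearMap.toMatrixRight' S.symm.toLinearMap
    have hM : ∀ c, Matrix.vecMul c M = S c := fun c =>
      LinearMap.congr_fun (LinearMap.toMatrixRight'.symm_apply_apply S.toLinearMap) c
    have hM' : ∀ c, Matrix.vecMul c M' = S.symm c := fun c =>
      LinearMap.congr_fun (LinearMap.toMatrixRight'.symm_apply_apply S.symm.toLinearMap) c
    have ext_vecMul : ∀ B C : Matrix n n ℂ, (∀ c, Matrix.vecMul c B = Matrix.vecMul c C) → B = C := by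
      intro B C h
      ext i j
      simpa using congrFun (h (Pi.single i 1)) j
    have h1 : M * M' = 1 := ext_vecMul _ _ fun c => by
      rw [← Matrix.vecMul_vecMul, hM, hM', Matrix.vecMul_one, LinearEquiv.symm_apply_apply]
    have h2 : M' * M = 1 := ext_vecMul _ _ fun c => by
      rw [← Matrix.vecMul_vecMul, hM, hM', Matrix.vecMul_one, LinearEquiv.apply_symm_apply]
    refine ⟨e, ⟨M, M', h1, h2⟩, ?_⟩
    change A = M * _ * M'
    have h3 : A * M = M * (jordanMatrix ν).submatrix e e := ext_vecMul _ _ fun c => by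
      rw [← Matrix.vecMul_vecMul, ← Matrix.vecMul_vecMul, hM, hM, hS]
    rw [← h3, Matrix.mul_assoc, h1, Matrix.mul_one]

theorem HasJordanType.submatrix {n n' : Type} [Fintype n] [DecidableEq n] [Fintype n']
    [DecidableEq n'] {k : ℕ} {A : Matrix n n ℂ} {ν : Fin k → ℕ} (hA : HasJordanType A ν)
    (e : n' ≃ n) : HasJordanType (A.submatrix e e) ν := by
  rw [hasJordanType_iff] at hA ⊢
  obtain ⟨T, hT⟩ := hA
  refine ⟨LinearEquiv.funCongrLeft ℂ ℂ e.symm ≪≫ₗ T, fun c => ?_⟩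
  change T (Matrix.vecMul c _ ∘ e.symm) = Matrix.vecMul (T (c ∘ e.symm)) _
  rw [← hT, Matrix.submatrix_vecMul_equiv]
  congr 1
  funext q
  simp

theorem jordanMatrix_pow_apply {m : ℕ} (ν : Fin m → ℕ) (k : ℕ) (p q : BlockIndex ν) :
    (jordanMatrix ν ^ k) p q = if p.1 = q.1 ∧ q.2.val = p.2.val + k then 1 else 0 := by
  induction k generalizing p with
  | zero =>
    obtain ⟨i, a⟩ := p
    obtain ⟨j, b⟩ := q
    rw [pow_zero, Matrix.one_apply]
    congr 1
    rw [eq_iff_iff, Sigma.mk.injEq]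
    constructor
    · rintro ⟨rfl, h⟩
      simp [eq_of_heq h]
    · rintro ⟨h1, h2⟩
      simp only at h1 h2
      subst h1
      exact ⟨rfl, heq_of_eq (Fin.ext h2.symm)⟩
  | succ k ih =>
    rw [pow_succ', Matrix.mul_apply]
    by_cases hp : p.2.val + 1 < ν p.1
    · rw [Finset.sum_eq_single ⟨p.1, p.2.val + 1, hp⟩, ih]
      · simp only [jordanMatrix, and_self, if_true, one_mul, add_assoc, add_comm 1 k]
      · intro r _ hr
        rw [jordanMatrix, if_neg, zero_mul]
        rintro ⟨h1, h2⟩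
        apply hr
        obtain ⟨i, a⟩ := p
        obtain ⟨j, b⟩ := r
        simp only at h1 h2
        subst h1
        exact Sigma.ext rfl (heq_of_eq (Fin.ext h2))
      · simp
    · rw [Finset.sum_eq_zero, if_neg]
      · rintro ⟨h1, h2⟩
        have h3 := congrArg ν h1
        have := q.2.2
        lia
      · intro r _
        rw [jordanMatrix, if_neg, zero_mul]
        rintro ⟨h1, h2⟩
        have h3 := congrArg ν h1
        have := r.2.2
        lia

open scoped ComplexOrder in
theorem rank_jordanMatrix_pow {m : ℕ} (ν : Fin m → ℕ) (k : ℕ) :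
    (jordanMatrix ν ^ k).rank = ∑ j, (ν j - k) := by
  classical
  -- The product with the adjoint is the projection onto the basis vectors that survive k shifts, so
  -- the rank becomes a count.
  have h : jordanMatrix ν ^ k * (jordanMatrix ν ^ k).conjTranspose =
      Matrix.diagonal fun p : BlockIndex ν => if p.2.val + k < ν p.1 then (1 : ℂ) else 0 := by
    ext p r
    simp only [Matrix.mul_apply, Matrix.conjTranspose_apply, jordanMatrix_pow_apply,
      Matrix.diagonal_apply]
    by_cases hp : p.2.val + k < ν p.1
    · rw [Finset.sum_eq_single ⟨p.1, p.2.val + k, hp⟩]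
      · by_cases hpr : p = r
        · subst hpr; simp [hp]
        · rw [if_neg hpr, if_neg (c := r.1 = p.1 ∧ _), star_zero, mul_zero]
          rintro ⟨h1, h2⟩
          apply hpr
          obtain ⟨i, a⟩ := p
          obtain ⟨j, b⟩ := r
          simp only at h1 h2
          subst h1
          exact Sigma.ext rfl (heq_of_eq (Fin.ext (by lia)))
      · intro q _ hq
        rw [if_neg, zero_mul]
        rintro ⟨h1, h2⟩
        apply hq
        obtain ⟨i, a⟩ := p
        obtain ⟨j, b⟩ := q
        simp only at h1 h2
        subst h1
        exact Sigma.ext rfl (heq_of_eq (Fin.ext h2))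
      · simp
    · simp only [hp, if_false, ite_self]
      refine Finset.sum_eq_zero fun q _ => ?_
      rw [if_neg, zero_mul]
      rintro ⟨h1, h2⟩
      have h3 := congrArg ν h1
      have := q.2.2
      lia
  rw [← Matrix.rank_self_mul_conjTranspose, h, Matrix.rank_diagonal, Fintype.card_subtype]
  have : (Finset.univ.filter fun p : BlockIndex ν =>
      (if p.2.val + k < ν p.1 then (1 : ℂ) else 0) ≠ 0) =
      Finset.univ.sigma fun j => Finset.univ.filter fun a : Fin (ν j) => a.val + k < ν j := by
    ext p
    simp
  rw [this, Finset.card_sigma]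
  refine Finset.sum_congr rfl fun j _ => ?_
  rw [← Finset.card_range (ν j - k)]
  refine Finset.card_bij (fun a _ => a.val) ?_ ?_ ?_
  · intro a ha
    simp only [Finset.mem_filter, Finset.mem_univ, true_and, Finset.mem_range] at ha ⊢
    lia
  · exact fun a _ b _ h => Fin.ext h
  · intro b hb
    rw [Finset.mem_range] at hb
    exact ⟨⟨b, by lia⟩, by simp; lia, rfl⟩

theorem HasJordanType.rank_pow {n : Type} [Fintype n] [DecidableEq n] {m : ℕ} {A : Matrix n n ℂ}
    {ν : Fin m → ℕ} (hA : HasJordanType A ν) (k : ℕ) : (A ^ k).rank = ∑ j, (ν j - k) := by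
  obtain ⟨e, P, rfl⟩ := hA
  have h : (P.1 * (jordanMatrix ν).submatrix e e * (P⁻¹).1) ^ k =
      P.1 * (jordanMatrix ν ^ k).submatrix e e * (P⁻¹).1 := by
    rw [Units.conj_pow]
    congr 2
    exact (map_pow (Matrix.reindexAlgEquiv ℂ ℂ e.symm) (jordanMatrix ν) k).symm
  rw [h, Matrix.rank_mul_eq_left_of_isUnit_det _ _ ((Matrix.isUnit_iff_isUnit_det _).1 P⁻¹.isUnit),
    Matrix.rank_mul_eq_right_of_isUnit_det _ _ ((Matrix.isUnit_iff_isUnit_det _).1 P.isUnit),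
    Matrix.rank_submatrix, rank_jordanMatrix_pow]

/-- First differences in k count the parts exceeding k, second differences the parts of each size;
equal fibres then give the permutation. -/
theorem exists_perm_of_sum_sub_eq {m : ℕ} {ν ν' : Fin m → ℕ}
    (h : ∀ k, ∑ j, (ν j - k) = ∑ j, (ν' j - k)) : ∃ σ : Equiv.Perm (Fin m), ν ∘ σ = ν' := by
  have hlt : ∀ (κ : Fin m → ℕ) (k : ℕ),
      ∑ j, (κ j - k) = ∑ j, (κ j - (k + 1)) + (Finset.univ.filter fun j => k < κ j).card := by
    intro κ k
    rw [Finset.card_filter, ← Finset.sum_add_distrib]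
    refine Finset.sum_congr rfl fun j _ => ?_
    split_ifs <;> lia
  have hlt' : ∀ k, (Finset.univ.filter fun j => k < ν j).card =
      (Finset.univ.filter fun j => k < ν' j).card := by
    intro k
    have h1 := hlt ν k
    have h2 := hlt ν' k
    have h3 := h k
    have h4 := h (k + 1)
    lia
  have hle : ∀ k, (Finset.univ.filter fun j => k ≤ ν j).card =
      (Finset.univ.filter fun j => k ≤ ν' j).card := by
    -- Zero parts are controlled because both families have m members.
    rintro (_ | k)
    · simp
    · exact hlt' k
  have heq : ∀ (κ : Fin m → ℕ) (k : ℕ), (Finset.univ.filter fun j => k ≤ κ j).card =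
      (Finset.univ.filter fun j => κ j = k).card + (Finset.univ.filter fun j => k < κ j).card := by
    intro κ k
    simp only [Finset.card_filter]
    rw [← Finset.sum_add_distrib]
    refine Finset.sum_congr rfl fun j _ => ?_
    split_ifs <;> lia
  have hcard : ∀ k, Fintype.card {j // ν' j = k} = Fintype.card {j // ν j = k} := by
    intro k
    rw [Fintype.card_subtype, Fintype.card_subtype]
    have h1 := heq ν k
    have h2 := heq ν' k
    have h3 := hle k
    have h4 := hlt' k
    lia
  exact ⟨Equiv.ofFiberEquiv fun k => Fintype.equivOfCardEq (hcard k),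
    funext fun j => Equiv.ofFiberEquiv_map _ j⟩

theorem HasJordanType.exists_perm {n : Type} [Fintype n] [DecidableEq n] {m : ℕ}
    {A : Matrix n n ℂ} {ν ν' : Fin m → ℕ} (h : HasJordanType A ν) (h' : HasJordanType A ν') :
    ∃ σ : Equiv.Perm (Fin m), ν ∘ σ = ν' :=
  exists_perm_of_sum_sub_eq fun k => by rw [← h.rank_pow, ← h'.rank_pow]

/-! ### Schubert cells -/

theorem quotientEquiv_vecMul {m : ℕ} {μ : Fin m → ℕ} {A : Matrix (BlockIndex μ) (BlockIndex μ) ℂ}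
    (hA : IsJordanLike A) (hg : IsTriangular μ (gSeries A)) (c : BlockIndex μ → ℂ) :
    quotientEquiv hg (Matrix.vecMul c A) = (PowerSeries.X : ℂ⟦X⟧) • quotientEquiv hg c := by
  rw [quotientEquiv_apply, quotientEquiv_apply, ← map_smul]
  exact ((Submodule.Quotient.eq _).2 (X_smul_blockVec_sub_mem hA c)).symm

theorem hasJordanType_of_mem_schubertCell {m : ℕ} {μ : Fin m → ℕ}
    {A : Matrix (BlockIndex μ) (BlockIndex μ) ℂ} (hA : IsJordanLike A) (hA' : A ∈ strictlyUpper μ)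
    {ν : Fin m → ℕ} (h : mvMap μ A ∈ schubertCell ν) : HasJordanType A ν := by
  obtain ⟨h, hh⟩ := h
  rw [mvMap_eq, latticeOf_toLaurent_inj, ← gSeries_jordanMatrix] at hh
  -- The element of GL_m(𝒪) carries t^ν 𝒪^m onto the lattice, so the quotients are isomorphic
  -- 𝒪-modules; read in monomial bases, this intertwines `A` with the Jordan matrix.
  let f : (Fin m → ℂ⟦X⟧) ≃ₗ[ℂ⟦X⟧] (Fin m → ℂ⟦X⟧) := Matrix.toLin'OfInv h.inv_val h.val_inv
  have hf : (colLattice (gSeries (jordanMatrix ν))).map (f : _ →ₗ[ℂ⟦X⟧] _) =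
      colLattice (gSeries A) := by
    rw [hh, colLattice, colLattice, Matrix.mulVecLin_mul, LinearMap.range_comp]
    rfl
  let Q := Submodule.Quotient.equiv _ _ f hf
  let q₁ := quotientEquiv (isTriangular_gSeries hA')
  let q₂ := quotientEquiv (isTriangular_gSeries (jordanMatrix_mem_strictlyUpper ν))
  refine (hasJordanType_iff A ν).2 ⟨q₁ ≪≫ₗ (Q.symm.restrictScalars ℂ) ≪≫ₗ q₂.symm, fun c => ?_⟩
  simp only [LinearEquiv.trans_apply, LinearEquiv.restrictScalars_apply]
  rw [LinearEquiv.symm_apply_eq, quotientEquiv_vecMul (fun _ _ _ => rfl),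
    quotientEquiv_vecMul hA, map_smul]
  congr 1
  exact (q₂.apply_symm_apply _).symm

theorem IsTriangular.det_ne_zero {m : ℕ} {μ : Fin m → ℕ} {g : Matrix (Fin m) (Fin m) ℂ⟦X⟧}
    (hg : IsTriangular μ g) : g.det ≠ 0 := by
  rw [Matrix.det_of_isLowerTriangular g fun i j h => hg.upper i j h, Finset.prod_ne_zero_iff]
  intro i _
  rw [hg.diag]
  exact pow_ne_zero _ PowerSeries.X_ne_zero

theorem IsTriangular.mulVecLin_injective {m : ℕ} {μ : Fin m → ℕ}
    {g : Matrix (Fin m) (Fin m) ℂ⟦X⟧} (hg : IsTriangular μ g) :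
    Function.Injective g.mulVecLin := by
  rw [← LinearMap.ker_eq_bot, LinearMap.ker_eq_bot']
  exact fun v hv => Matrix.eq_zero_of_mulVec_eq_zero hg.det_ne_zero hv

/-- Smith normal form over the discrete valuation ring 𝒪; units in the elementary divisors do not
change the span. -/
theorem IsTriangular.exists_basis {m : ℕ} {μ : Fin m → ℕ} {g : Matrix (Fin m) (Fin m) ℂ⟦X⟧}
    (hg : IsTriangular μ g) :
    ∃ (b : Module.Basis (Fin m) ℂ⟦X⟧ (Fin m → ℂ⟦X⟧)) (ν : Fin m → ℕ),
      colLattice g = Submodule.span ℂ⟦X⟧ (Set.range fun i => (PowerSeries.X ^ ν i : ℂ⟦X⟧) • b i) := by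
  obtain ⟨b, a, ab, hab⟩ := Submodule.exists_smith_normal_form_of_rank_eq
    (Pi.basisFun ℂ⟦X⟧ (Fin m)) (LinearMap.finrank_range_of_inj hg.mulVecLin_injective)
  have ha : ∀ i, a i ≠ 0 := by
    intro i hi
    refine ab.ne_zero i (Subtype.ext ?_)
    rw [hab, hi, zero_smul]
    rfl
  choose ν u hu using fun i =>
    IsDiscreteValuationRing.eq_unit_mul_pow_irreducible (ha i) PowerSeries.X_irreducible
  refine ⟨b, ν, ?_⟩
  have hspan : colLattice g = Submodule.span ℂ⟦X⟧ (Set.range fun i => a i • b i) := by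
    have := congrArg (Submodule.map (LinearMap.range g.mulVecLin).subtype) ab.span_eq
    rw [Submodule.map_span, Submodule.map_top, Submodule.range_subtype, ← Set.range_comp] at this
    rw [colLattice, ← this]
    congr 2
    funext i
    exact hab i
  rw [hspan]
  refine le_antisymm ?_ ?_ <;> rw [Submodule.span_le, Set.range_subset_iff] <;> intro i
  · rw [hu, mul_smul]
    exact Submodule.smul_mem _ _ (Submodule.subset_span ⟨i, rfl⟩)
  · have : (PowerSeries.X ^ ν i : ℂ⟦X⟧) • b i = (↑(u i)⁻¹ : ℂ⟦X⟧) • a i • b i := by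
      rw [hu, smul_smul, ← mul_assoc, Units.inv_mul, one_mul]
    simp only [SetLike.mem_coe]
    rw [this]
    exact Submodule.smul_mem _ _ (Submodule.subset_span ⟨i, rfl⟩)

theorem mem_schubertCell_of_basis {m : ℕ} {g : Matrix (Fin m) (Fin m) ℂ⟦X⟧}
    (b : Module.Basis (Fin m) ℂ⟦X⟧ (Fin m → ℂ⟦X⟧)) (ν : Fin m → ℕ)
    (h : colLattice g = Submodule.span ℂ⟦X⟧ (Set.range fun i => (PowerSeries.X ^ ν i : ℂ⟦X⟧) • b i)) :
    latticeOf (toLaurent g) ∈ schubertCell ν := by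
  refine ⟨⟨(Pi.basisFun ℂ⟦X⟧ (Fin m)).toMatrix b, b.toMatrix (Pi.basisFun ℂ⟦X⟧ (Fin m)),
    Module.Basis.toMatrix_mul_toMatrix_flip _ _, Module.Basis.toMatrix_mul_toMatrix_flip _ _⟩, ?_⟩
  rw [latticeOf_toLaurent_inj, h, colLattice_eq_span]
  congr 2
  funext j i
  simp [tPow, Module.Basis.toMatrix_apply, mul_comm]

theorem mvMap_mem_schubertCell_iff {m : ℕ} {μ : Fin m → ℕ}
    {A : Matrix (BlockIndex μ) (BlockIndex μ) ℂ} (hA : IsJordanLike A) (hA' : A ∈ strictlyUpper μ)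
    (ν : Fin m → ℕ) : mvMap μ A ∈ schubertCell ν ↔ HasJordanType A ν := by
  refine ⟨hasJordanType_of_mem_schubertCell hA hA', fun h => ?_⟩
  -- The lattice lies in some cell κ, so `A` also has type κ. Ranks of powers force κ and ν to agree
  -- up to order, and permuting the adapted basis absorbs the order.
  obtain ⟨b, κ, hb⟩ := (isTriangular_gSeries hA').exists_basis
  have hκ : mvMap μ A ∈ schubertCell κ := mem_schubertCell_of_basis b κ hb
  obtain ⟨σ, rfl⟩ := (hasJordanType_of_mem_schubertCell hA hA' hκ).exists_perm h
  refine mem_schubertCell_of_basis (b.reindex σ.symm) (κ ∘ σ) ?_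
  change colLattice (gSeries A) = _
  rw [hb]
  congr 1
  rw [← σ.surjective.range_comp]
  congr 1
  funext i
  simp

/-! ### Truncation -/

/-- By lower triangularity the first i coordinates of gw depend only on those of w, and any such
coordinates extend by zero. -/
theorem truncate_latticeOf {m : ℕ} {i : ℕ} (hi : i ≤ m) {g : Matrix (Fin m) (Fin m) ℂ⟦X⟧}
    (hg : ∀ a b, a < b → g a b = 0) :
    truncate i hi (latticeOf (toLaurent g)) =
      latticeOf (toLaurent (g.submatrix (Fin.castLE hi) (Fin.castLE hi))) := by
  have key : ∀ w : Fin m → ℂ⟦X⟧, (g.mulVec w) ∘ Fin.castLE hi =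
      (g.submatrix (Fin.castLE hi) (Fin.castLE hi)).mulVec (w ∘ Fin.castLE hi) := by
    intro w
    funext a
    simp only [Function.comp_apply, Matrix.mulVec, dotProduct, Matrix.submatrix_apply]
    refine (Fintype.sum_of_injective (Fin.castLE hi) (Fin.castLE_injective hi) _ _ ?_ ?_).symm
    · intro j hj
      rw [hg _ _ ?_, zero_mul]
      by_contra hle
      refine hj ⟨⟨j.val, ?_⟩, rfl⟩
      have := a.2
      simp only [Fin.lt_def, Fin.val_castLE] at hle
      lia
    · exact fun _ => rfl
  rw [truncate, latticeOf_toLaurent, latticeOf_toLaurent, ← Submodule.map_comp]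
  ext v
  simp only [colLattice, Submodule.mem_map, LinearMap.mem_range]
  constructor
  · rintro ⟨_, ⟨w, rfl⟩, rfl⟩
    refine ⟨_, ⟨w ∘ Fin.castLE hi, rfl⟩, ?_⟩
    rw [Matrix.mulVecLin_apply, ← key]
    rfl
  · rintro ⟨_, ⟨w, rfl⟩, rfl⟩
    let w' : Fin m → ℂ⟦X⟧ := fun j => if h : j.val < i then w ⟨j.val, h⟩ else 0
    have hw : w' ∘ Fin.castLE hi = w := by
      funext a
      simp [w']
    refine ⟨_, ⟨w', rfl⟩, ?_⟩
    rw [Matrix.mulVecLin_apply, Matrix.mulVecLin_apply, ← hw, ← key]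
    rfl

/-- The inclusion of the first `i` blocks. -/
def blockCastLE {m : ℕ} (μ : Fin m → ℕ) {i : ℕ} (hi : i ≤ m)
    (p : BlockIndex (μ ∘ Fin.castLE hi)) : BlockIndex μ :=
  ⟨Fin.castLE hi p.1, p.2⟩

/-- The indices of the first `i` blocks. -/
def leadingEquiv {m : ℕ} (μ : Fin m → ℕ) {i : ℕ} (hi : i ≤ m) :
    BlockIndex (μ ∘ Fin.castLE hi) ≃ {p : BlockIndex μ // p.1.val < i} where
  toFun p := ⟨blockCastLE μ hi p, p.1.2⟩
  invFun p := ⟨⟨p.1.1.val, p.2⟩, p.1.2⟩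
  left_inv _ := rfl
  right_inv _ := rfl

theorem gSeries_submatrix {m : ℕ} {μ : Fin m → ℕ} {i : ℕ} (hi : i ≤ m)
    (A : Matrix (BlockIndex μ) (BlockIndex μ) ℂ) :
    gSeries (A.submatrix (blockCastLE μ hi) (blockCastLE μ hi)) =
      (gSeries A).submatrix (Fin.castLE hi) (Fin.castLE hi) := by
  ext1 a b
  rw [Matrix.submatrix_apply, gSeries_apply, gSeries_apply]
  congr 1
  simp [Fin.ext_iff]

theorem truncate_mvMap {m : ℕ} {μ : Fin m → ℕ} {i : ℕ} (hi : i ≤ m)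
    {A : Matrix (BlockIndex μ) (BlockIndex μ) ℂ} (hA : A ∈ strictlyUpper μ) :
    truncate i hi (mvMap μ A) =
      mvMap _ (A.submatrix (blockCastLE μ hi) (blockCastLE μ hi)) := by
  rw [mvMap_eq, mvMap_eq, truncate_latticeOf hi (isTriangular_gSeries hA).upper, gSeries_submatrix]

theorem truncate_mvMap_mem_schubertCell_iff {m : ℕ} {μ : Fin m → ℕ} {i : ℕ} (hi : i ≤ m)
    {A : Matrix (BlockIndex μ) (BlockIndex μ) ℂ} (hA : IsJordanLike A) (hA' : A ∈ strictlyUpper μ)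
    (ν : Fin i → ℕ) :
    truncate i hi (mvMap μ A) ∈ schubertCell ν ↔ HasJordanType (leadingSubmatrix i A) ν := by
  rw [truncate_mvMap hi hA', mvMap_mem_schubertCell_iff]
  · exact ⟨fun h => h.submatrix (leadingEquiv μ hi).symm, fun h => h.submatrix (leadingEquiv μ hi)⟩
  · intro p q h
    rw [Matrix.submatrix_apply, hA _ _ h]
    simp [jordanMatrix, blockCastLE]
  · intro p q h
    refine hA' _ _ ?_
    rcases h with h | ⟨h1, h2⟩
    · exact Or.inl h
    · exact Or.inr ⟨congrArg (Fin.castLE hi) h1, h2⟩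

/-! ### Semi-infinite orbits -/

theorem IsTriangular.latticeOf_mem_semiInfiniteOrbit {m : ℕ} {μ : Fin m → ℕ}
    {g : Matrix (Fin m) (Fin m) ℂ⟦X⟧} (hg : IsTriangular μ g) :
    latticeOf (toLaurent g) ∈ semiInfiniteOrbit μ := by
  have hX : ∀ k : ℕ, algebraMap ℂ⟦X⟧ ℂ⸨X⸩ (PowerSeries.X ^ k) ≠ 0 := fun k h =>
    pow_ne_zero k PowerSeries.X_ne_zero
      (algebraMap_laurent_injective (h.trans (map_zero _).symm))
  refine ⟨Matrix.of fun i j => toLaurent g i j * (algebraMap ℂ⟦X⟧ ℂ⸨X⸩ (PowerSeries.X ^ μ j))⁻¹,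
    fun i => ?_, fun i j hij => ?_, ?_⟩
  · rw [Matrix.of_apply, toLaurent, Matrix.map_apply, hg.diag, mul_inv_cancel₀ (hX _)]
  · rw [Matrix.of_apply, toLaurent, Matrix.map_apply, hg.upper i j hij, map_zero, zero_mul]
  · congr 1
    have h : toLaurent (tPow μ) =
        Matrix.diagonal fun i => algebraMap ℂ⟦X⟧ ℂ⸨X⸩ (PowerSeries.X ^ μ i) := by
      rw [toLaurent, tPow, Matrix.diagonal_map (map_zero _)]
    ext1 i j
    rw [h, Matrix.mul_diagonal, Matrix.of_apply, inv_mul_cancel_right₀ (hX _)]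

theorem IsTriangular.latticeOf_mem_grPos {m : ℕ} {μ : Fin m → ℕ}
    {g : Matrix (Fin m) (Fin m) ℂ⟦X⟧} (hg : IsTriangular μ g) :
    latticeOf (toLaurent g) ∈ GrPos m := by
  refine ⟨⟨Matrix.GeneralLinearGroup.mkOfDetNeZero (toLaurent g) ?_, rfl⟩,
    latticeOf_toLaurent_le g⟩
  have h : (toLaurent g).det = algebraMap ℂ⟦X⟧ ℂ⸨X⸩ g.det := ((algebraMap ℂ⟦X⟧ ℂ⸨X⸩).map_det g).symm
  rw [h]
  exact fun h0 => hg.det_ne_zero (algebraMap_laurent_injective (h0.trans (map_zero _).symm))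

theorem exists_isTriangular_of_mem_semiInfiniteOrbit {m : ℕ} {μ : Fin m → ℕ} {L : LatticeSpace m}
    (hL : L ∈ semiInfiniteOrbit μ) (hle : L ≤ stdLattice m) :
    ∃ g, IsTriangular μ g ∧ L = latticeOf (toLaurent g) := by
  obtain ⟨n, hn1, hn0, rfl⟩ := hL
  -- Columns are images of standard basis vectors, so containment in 𝒪^m makes all entries integral.
  have hcol : ∀ j, ∃ v, incl m v = (n * toLaurent (tPow μ)).col j := by
    intro j
    refine LinearMap.mem_range.1 (hle ⟨incl m (Pi.single j 1), ⟨_, rfl⟩, ?_⟩)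
    have h : incl m (Pi.single j 1) = Pi.single j 1 := by
      funext i
      rw [incl_apply]
      by_cases hij : i = j
      · subst hij; simp
      · simp [hij]
    rw [h]
    simp
    rfl
  choose v hv using hcol
  have hv' : ∀ i j, algebraMap ℂ⟦X⟧ ℂ⸨X⸩ (v j i) =
      n i j * algebraMap ℂ⟦X⟧ ℂ⸨X⸩ (PowerSeries.X ^ μ j) := by
    intro i j
    have := congrFun (hv j) i
    rwa [incl_apply, Matrix.col_apply, toLaurent, tPow, Matrix.diagonal_map (map_zero _),
      Matrix.mul_diagonal] at this
  refine ⟨fun i j => v j i, ⟨fun i => algebraMap_laurent_injective ?_,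
    fun i j hij => algebraMap_laurent_injective ?_⟩, ?_⟩
  · rw [hv', hn1, one_mul]
  · rw [hv', hn0 i j hij, zero_mul, map_zero]
  · congr 1
    ext1 i j
    exact (congrFun (hv j) i).symm

/-- Column reduction of a positive lattice in the semi-infinite orbit. -/
theorem exists_eq_mvMap {m : ℕ} {μ : Fin m → ℕ} (hdom : Antitone μ) {L : LatticeSpace m}
    (hL : L ∈ semiInfiniteOrbit μ) (hle : L ≤ stdLattice m) :
    ∃ A ∈ slice μ, A ∈ strictlyUpper μ ∧ L = mvMap μ A := by
  obtain ⟨g, hg, rfl⟩ := exists_isTriangular_of_mem_semiInfiniteOrbit hL hle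
  have hex : ∀ j : Fin m, ∃ c : BlockIndex μ → ℂ, (∀ p, p.1 ≤ j → c p = 0) ∧
      Pi.single j (PowerSeries.X ^ μ j) - blockVec μ c ∈ colLattice g := by
    intro j
    obtain ⟨c, hc, hmem⟩ := hg.exists_blockVec_sub_mem_of_lt (m - (j.val + 1)) (j.val + 1)
      -- Subtracting column j first clears coordinates up to j, so the remainder is supported in
      -- later blocks.
      (by have := j.2; lia) (Pi.single j (PowerSeries.X ^ μ j) - g.col j) (by
        intro i hi
        rw [Pi.sub_apply, Matrix.col_apply]
        rcases eq_or_ne i j with rfl | hij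
        · rw [Pi.single_eq_same, hg.diag, sub_self]
        · have hlt : i < j := lt_of_le_of_ne (Fin.le_def.2 (Nat.lt_succ_iff.1 hi)) hij
          rw [Pi.single_eq_of_ne hij, hg.upper i j hlt, sub_self])
    refine ⟨c, fun p hp => hc p (Nat.lt_succ_of_le hp), ?_⟩
    convert add_mem hmem (col_mem_colLattice g j) using 1
    abel
  choose c hc hmem using hex
  let A : Matrix (BlockIndex μ) (BlockIndex μ) ℂ := fun p q =>
    if p.2.val + 1 = μ p.1 then c p.1 q else jordanMatrix μ p q
  have hA : A ∈ strictlyUpper μ := by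
    intro p q hpq
    simp only [A]
    rw [jordanMatrix_mem_strictlyUpper μ p q hpq, hc, ite_self]
    rcases hpq with h | h
    · exact h.le
    · exact h.1.le
  refine ⟨A, ?_, hA, ?_⟩
  · intro p q hpq
    by_cases hp : p.2.val + 1 = μ p.1
    · have hlt : q.1 < p.1 := by
        by_contra h
        have h1 := hdom (not_lt.1 h)
        have h2 := q.2.2
        rcases hpq with h | h
        · exact h hp
        · rw [min_eq_right h1] at h
          lia
      rw [hA p q (Or.inl hlt), jordanMatrix_mem_strictlyUpper μ p q (Or.inl hlt)]
    · simp only [A, hp, if_false]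
  · rw [mvMap_eq, latticeOf_toLaurent_inj]
    refine ((isTriangular_gSeries hA).colLattice_eq_of_le hg (colLattice_le_iff.2 fun j => ?_)).symm
    rcases Nat.eq_zero_or_pos (μ j) with h | h
    -- Blocks after an empty one are empty too.
    · have h0 : c j = 0 := by
        funext p
        rcases le_total p.1 j with hp | hp
        · exact hc j p hp
        · have h1 := hdom hp
          have h2 := p.2.2
          lia
      have := hmem j
      rwa [h0, map_zero, sub_zero, h, pow_zero, ← gSeries_col_of_eq_zero A h] at this
    · rw [gSeries_col A h]
      have : A ⟨j, μ j - 1, Nat.sub_lt h one_pos⟩ = c j := by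
        funext q
        exact if_pos (Nat.sub_add_cancel h)
      rw [this]
      exact hmem j

/-! ### The sets `X̊(τ)` and `Z̊(τ)` -/

theorem mvMap_mem_openZ_iff {m : ℕ} {μ : Fin m → ℕ} {lam : YoungDiagram}
    {τ : SemistandardYoungTableau lam} {A : Matrix (BlockIndex μ) (BlockIndex μ) ℂ}
    (hA : A ∈ slice μ) (hA' : A ∈ strictlyUpper μ) : mvMap μ A ∈ openZ μ τ ↔ A ∈ openX μ τ := by
  have key := fun (i : ℕ) (hi : i ≤ m) => truncate_mvMap_mem_schubertCell_iff hi
    (isJordanLike_of_mem_slice hA) hA' (subShape τ i)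
  constructor
  · exact fun h => ⟨hA, hA', fun i h1 hi => (key i hi).1 (h.2 i h1 hi)⟩
  · exact fun h => ⟨(isTriangular_gSeries hA').latticeOf_mem_semiInfiniteOrbit,
      fun i h1 hi => (key i hi).2 (h.2.2 i h1 hi)⟩

theorem truncate_self {m : ℕ} (L : LatticeSpace m) : truncate m le_rfl L = L := by
  ext v
  simp only [truncate, Submodule.mem_map]
  constructor
  · rintro ⟨w, hw, rfl⟩
    exact hw
  · exact fun hv => ⟨v, hv, rfl⟩

/-- Integrality comes from the cell condition at i = m; for m = 0 there is no such condition, but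
the space is zero. -/
theorem le_stdLattice_of_mem_openZ {m : ℕ} {μ : Fin m → ℕ} {lam : YoungDiagram}
    {τ : SemistandardYoungTableau lam} {L : LatticeSpace m} (hL : L ∈ openZ μ τ) :
    L ≤ stdLattice m := by
  rcases Nat.eq_zero_or_pos m with rfl | hm
  · intro v _
    rw [Subsingleton.elim v 0]
    exact zero_mem _
  · have := hL.2 m hm le_rfl
    rw [truncate_self] at this
    obtain ⟨g, rfl⟩ := this
    exact latticeOf_toLaurent_le _

theorem exists_eq_mvMap_of_mem_openZ {m : ℕ} {μ : Fin m → ℕ} (hdom : Antitone μ)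
    {lam : YoungDiagram} {τ : SemistandardYoungTableau lam} {L : LatticeSpace m}
    (hL : L ∈ openZ μ τ) : ∃ A ∈ openX μ τ, L = mvMap μ A := by
  obtain ⟨A, hA, hA', rfl⟩ := exists_eq_mvMap hdom hL.1 (le_stdLattice_of_mem_openZ hL)
  exact ⟨A, (mvMap_mem_openZ_iff hA hA').1 hL, rfl⟩

/-! ### Coordinates in the charts of the Grassmannian -/

theorem monomialVec_eq {m : ℕ} (p : ℕ × Fin m) :
    monomialVec p = incl m (Pi.single p.2 (PowerSeries.X ^ p.1)) := by
  funext i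
  rw [incl_apply, monomialVec]
  by_cases h : i = p.2
  · subst h
    rw [Pi.single_eq_same, Pi.single_eq_same]
    rfl
  · rw [Pi.single_eq_of_ne h, Pi.single_eq_of_ne h, map_zero]

/-- The coordinates of the class of `t^k e_j` modulo `g(A) 𝒪^m` in the monomial basis. -/
def monomialRow {m : ℕ} {μ : Fin m → ℕ} {R : Type} [CommRing R]
    (A : Matrix (BlockIndex μ) (BlockIndex μ) R) (v : ℕ × Fin m) : BlockIndex μ → R :=
  if h : 0 < μ v.2 then (A ^ v.1) ⟨v.2, 0, h⟩ else 0

/-- Applied to the matrix of indeterminates, this shows that the coordinates of monomials are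
polynomials in the entries of `A`. -/
theorem monomialRow_map {m : ℕ} {μ : Fin m → ℕ} {R S : Type} [CommRing R] [CommRing S]
    (f : R →+* S) (A : Matrix (BlockIndex μ) (BlockIndex μ) R) (v : ℕ × Fin m) (q : BlockIndex μ) :
    f (monomialRow A v q) = monomialRow (A.map f) v q := by
  unfold monomialRow
  split_ifs
  · exact congrFun (congrFun (map_pow f.mapMatrix A v.1) _) q
  · exact map_zero f

/-- Multiply e_j, the first monomial of its block, k times by t. If block j is empty, e_j already
lies in the lattice and the class is zero. -/
theorem single_sub_monomialRow_mem {m : ℕ} {μ : Fin m → ℕ}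
    {A : Matrix (BlockIndex μ) (BlockIndex μ) ℂ} (hA : IsJordanLike A) (v : ℕ × Fin m) :
    Pi.single v.2 (PowerSeries.X ^ v.1) - blockVec μ (monomialRow A v) ∈
      colLattice (gSeries A) := by
  obtain ⟨k, j⟩ := v
  rcases Nat.eq_zero_or_pos (μ j) with h | h
  · have h0 : monomialRow A (k, j) = 0 := dif_neg (by simp [h])
    have := (colLattice (gSeries A)).smul_mem (PowerSeries.X ^ k) (col_mem_colLattice (gSeries A) j)
    rw [gSeries_col_of_eq_zero A h, ← Pi.single_smul, smul_eq_mul, mul_one] at this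
    rwa [h0, map_zero, sub_zero]
  · have hrow : ∀ k, monomialRow A (k, j) = (A ^ k) ⟨j, 0, h⟩ := fun k => dif_pos h
    simp only [hrow]
    induction k with
    | zero =>
      have : ((1 : Matrix (BlockIndex μ) (BlockIndex μ) ℂ) ⟨j, 0, h⟩) =
          Pi.single (⟨j, 0, h⟩ : BlockIndex μ) 1 := by
        funext q
        rw [Matrix.one_apply, Pi.single_apply]
        simp only [eq_comm]
      rw [pow_zero, pow_zero, this, blockVec_single]
      simp
    | succ k ih =>
      have h1 := (colLattice (gSeries A)).smul_mem PowerSeries.X ih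
      have h2 := add_mem h1 (X_smul_blockVec_sub_mem hA ((A ^ k) ⟨j, 0, h⟩))
      rw [smul_sub, ← Pi.single_smul, smul_eq_mul, ← pow_succ', sub_add_sub_cancel,
        ← Matrix.mul_apply_eq_vecMul, ← pow_succ] at h2
      exact h2

theorem IsTriangular.eq_of_sub_mem {m : ℕ} {μ : Fin m → ℕ} {g : Matrix (Fin m) (Fin m) ℂ⟦X⟧}
    (hg : IsTriangular μ g) {w : Fin m → ℂ⟦X⟧} {c d : BlockIndex μ → ℂ}
    (hc : w - blockVec μ c ∈ colLattice g) (hd : w - blockVec μ d ∈ colLattice g) : c = d := by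
  have h := sub_mem hd hc
  rw [sub_sub_sub_cancel_left, ← map_sub] at h
  exact sub_eq_zero.1 (hg.eq_zero_of_blockVec_mem h)

/-- The coordinates of the monomials in `I`. -/
def monomialMatrix {m : ℕ} {μ : Fin m → ℕ} {R : Type} [CommRing R]
    (A : Matrix (BlockIndex μ) (BlockIndex μ) R) (I : Finset (ℕ × Fin m)) :
    Matrix I (BlockIndex μ) R :=
  fun p => monomialRow A p.1

/-- Passing to the standard monomial basis turns an expansion in another set `I` into a finite
linear system, so chart membership becomes invertibility of its matrix. -/
theorem isExpansion_iff {m : ℕ} {μ : Fin m → ℕ} {A : Matrix (BlockIndex μ) (BlockIndex μ) ℂ}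
    (hA : IsJordanLike A) (hA' : A ∈ strictlyUpper μ) {I : Finset (ℕ × Fin m)} {w : Fin m → ℂ⟦X⟧}
    {c : BlockIndex μ → ℂ} (hw : w - blockVec μ c ∈ colLattice (gSeries A)) (d : I → ℂ) :
    IsExpansion I (mvMap μ A) (incl m w) d ↔ Matrix.vecMul d (monomialMatrix A I) = c := by
  have h1 : incl m w - ∑ p : I, d p • monomialVec p.1 =
      incl m (w - ∑ p : I, d p • (Pi.single p.1.2 (PowerSeries.X ^ p.1.1) : Fin m → ℂ⟦X⟧)) := by
    rw [map_sub, map_sum]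
    simp only [incl_smul, monomialVec_eq]
  have h2 : ∑ p : I, d p • (Pi.single p.1.2 (PowerSeries.X ^ p.1.1) : Fin m → ℂ⟦X⟧) -
      blockVec μ (Matrix.vecMul d (monomialMatrix A I)) ∈ colLattice (gSeries A) := by
    rw [Matrix.vecMul_eq_sum, map_sum, ← Finset.sum_sub_distrib]
    refine sum_mem fun p _ => ?_
    rw [map_smul, ← smul_sub]
    exact ((colLattice (gSeries A)).restrictScalars ℂ).smul_mem (d p)
      (single_sub_monomialRow_mem hA p.1)
  rw [IsExpansion, h1, mvMap_eq, latticeOf_toLaurent, ← SetLike.mem_coe, Submodule.map_coe,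
    (incl_injective m).mem_set_image, SetLike.mem_coe]
  constructor
  · intro h
    have h3 := add_mem h h2
    rw [sub_add_sub_cancel] at h3
    exact (isTriangular_gSeries hA').eq_of_sub_mem h3 hw
  · rintro rfl
    have h3 := sub_mem hw h2
    rwa [sub_sub_sub_cancel_right] at h3

theorem mvMap_mem_dom_iff {m : ℕ} {μ : Fin m → ℕ} {A : Matrix (BlockIndex μ) (BlockIndex μ) ℂ}
    (hA : IsJordanLike A) (hA' : A ∈ strictlyUpper μ) (I : Finset (ℕ × Fin m)) :
    mvMap μ A ∈ (grAtlas m).dom I ↔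
      Function.Bijective fun d : I → ℂ => Matrix.vecMul d (monomialMatrix A I) := by
  rw [Function.bijective_iff_existsUnique]
  constructor
  · intro h c
    obtain ⟨d, hd, huniq⟩ := h.2 (incl m (blockVec μ c)) ⟨_, rfl⟩
    have key := isExpansion_iff hA hA' (I := I) (w := blockVec μ c) (c := c)
      (by rw [sub_self]; exact zero_mem _)
    exact ⟨d, (key d).1 hd, fun d' hd' => huniq d' ((key d').2 hd')⟩
  · refine fun h => ⟨(isTriangular_gSeries hA').latticeOf_mem_grPos, ?_⟩
    rintro _ ⟨w, rfl⟩
    obtain ⟨c, hc⟩ := (isTriangular_gSeries hA').exists_blockVec_sub_mem w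
    obtain ⟨d, hd, huniq⟩ := h c
    have key := isExpansion_iff hA hA' (I := I) hc
    exact ⟨d, (key d).2 hd, fun d' hd' => huniq d' ((key d').1 hd')⟩

theorem vecMul_coord {m : ℕ} {μ : Fin m → ℕ} {A : Matrix (BlockIndex μ) (BlockIndex μ) ℂ}
    (hA : IsJordanLike A) (hA' : A ∈ strictlyUpper μ) {I : Finset (ℕ × Fin m)}
    (hI : mvMap μ A ∈ (grAtlas m).dom I) (v : ℕ × Fin m) :
    Matrix.vecMul (fun p => (grAtlas m).coord I (mvMap μ A) (v, p)) (monomialMatrix A I) =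
      monomialRow A v := by
  refine (isExpansion_iff hA hA' (single_sub_monomialRow_mem hA v) _).1 ?_
  rw [← monomialVec_eq]
  refine Classical.epsilon_spec (p := IsExpansion I (mvMap μ A) (monomialVec v)) ?_
  rw [monomialVec_eq]
  exact (hI.2 _ ⟨_, rfl⟩).exists

theorem bijective_vecMul_iff {I n : Type} [Fintype I] [Fintype n] [DecidableEq n] (e : I ≃ n)
    (M : Matrix I n ℂ) :
    (Function.Bijective fun d : I → ℂ => Matrix.vecMul d M) ↔
      (M.submatrix e.symm id).det ≠ 0 := by
  have h : (fun d : I → ℂ => Matrix.vecMul d M) =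
      (fun d => Matrix.vecMul d (M.submatrix e.symm id)) ∘ (e.arrowCongr (Equiv.refl ℂ)) := by
    funext d
    refine ((Matrix.submatrix_vecMul_equiv M _ e.symm id).trans ?_).symm
    have hd : (e.arrowCongr (Equiv.refl ℂ) d) ∘ e.symm.symm = d := by
      funext i
      simp
    rw [hd]
    rfl
  rw [h, Equiv.bijective_comp, ← isUnit_iff_ne_zero, ← Matrix.isUnit_iff_isUnit_det]
  exact ⟨fun hb => Matrix.vecMul_injective_iff_isUnit.1 hb.1, fun hu =>
    ⟨Matrix.vecMul_injective_iff_isUnit.2 hu, Matrix.vecMul_surjective_iff_isUnit.2 hu⟩⟩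

/-- Cramer's rule for row vectors. -/
theorem eq_vecMul_adjugate_div {I n : Type} [Fintype I] [Fintype n] [DecidableEq n] (e : I ≃ n)
    {M : Matrix I n ℂ} (hM : (M.submatrix e.symm id).det ≠ 0) {d : I → ℂ} {r : n → ℂ}
    (h : Matrix.vecMul d M = r) (p : I) :
    d p = Matrix.vecMul r (M.submatrix e.symm id).adjugate (e p) /
      (M.submatrix e.symm id).det := by
  have h1 : Matrix.vecMul (d ∘ e.symm) (M.submatrix e.symm id) = r := by
    rw [Matrix.submatrix_vecMul_equiv, ← h]
    have hd : (d ∘ e.symm) ∘ e.symm.symm = d := by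
      funext i
      simp
    rw [hd]
    rfl
  rw [← h1, Matrix.vecMul_vecMul, Matrix.mul_adjugate, Matrix.vecMul_smul, Matrix.vecMul_one,
    eq_div_iff hM, mul_comm]
  simp

theorem map_mvPolynomialX_eval {n : Type} (A : Matrix n n ℂ) :
    (Matrix.mvPolynomialX n n ℂ).map
      (MvPolynomial.eval fun v => A v.1 v.2) = A := by
  ext i j
  simp

theorem isMorphism_mvMap {m : ℕ} (μ : Fin m → ℕ) {lam : YoungDiagram}
    (τ : SemistandardYoungTableau lam) :
    IsMorphism (matrixAtlas (BlockIndex μ)) (grAtlas m) (mvMap μ) (openX μ τ) (openZ μ τ) := by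
  refine isMorphism_of_charts (fun A hA => (mvMap_mem_openZ_iff hA.1 hA.2.1).2 hA) ?_
  intro A₀ hA₀ (I : Finset (ℕ × Fin m)) hI
  refine ⟨(), Set.mem_univ _, ?_⟩
  have hbij := (mvMap_mem_dom_iff (isJordanLike_of_mem_slice hA₀.1) hA₀.2.1 I).1 hI
  -- One point in the chart already forces `I` to have N elements, so the determinant makes sense
  -- for all `A`.
  have hcard : Fintype.card I = Fintype.card (BlockIndex μ) := by
    simpa only [Module.finrank_fintype_fun_eq_card] using
      (LinearEquiv.ofBijective (Matrix.vecMulLinear (monomialMatrix A₀ I)) hbij).finrank_eq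
  let e : I ≃ BlockIndex μ := Fintype.equivOfCardEq hcard
  let P := Matrix.mvPolynomialX (BlockIndex μ) (BlockIndex μ) ℂ
  let B := (monomialMatrix P I).submatrix e.symm id
  let ev := fun A : Matrix (BlockIndex μ) (BlockIndex μ) ℂ =>
    MvPolynomial.eval fun v : BlockIndex μ × BlockIndex μ => A v.1 v.2
  have hrow : ∀ (A : Matrix (BlockIndex μ) (BlockIndex μ) ℂ) v q,
      ev A (monomialRow P v q) =
        monomialRow A v q := by
    intro A v q
    rw [monomialRow_map, map_mvPolynomialX_eval]
  have hB : ∀ A : Matrix (BlockIndex μ) (BlockIndex μ) ℂ,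
      B.map (ev A) =
        (monomialMatrix A I).submatrix e.symm id := by
    intro A
    ext1 p q
    exact hrow A _ q
  have hdet : ∀ A : Matrix (BlockIndex μ) (BlockIndex μ) ℂ,
      ev A B.det =
        ((monomialMatrix A I).submatrix e.symm id).det := by
    intro A
    rw [← hB]
    exact RingHom.map_det _ B
  have hadj : ∀ (A : Matrix (BlockIndex μ) (BlockIndex μ) ℂ) (v : ℕ × Fin m) q,
      ev A
          (Matrix.vecMul (monomialRow P v) B.adjugate q) =
        Matrix.vecMul (monomialRow A v) ((monomialMatrix A I).submatrix e.symm id).adjugate q := by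
    intro A v q
    rw [← hB]
    have h := RingHom.map_adjugate
      (ev A) B
    rw [RingHom.mapMatrix_apply, RingHom.mapMatrix_apply] at h
    have hv : ev A ∘ monomialRow P v = monomialRow A v := funext fun q => hrow A v q
    rw [← h, RingHom.map_vecMul, hv]
  refine ⟨B.det, fun v => Matrix.vecMul (monomialRow P v.1) B.adjugate (e v.2), ?_, ?_⟩
  · refine (hdet A₀).trans_ne ?_
    exact (bijective_vecMul_iff e _).1 hbij
  · intro A hA hD
    replace hD := (hdet A).symm.trans_ne hD
    have hJ := isJordanLike_of_mem_slice hA.1.1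
    have hdom := (mvMap_mem_dom_iff hJ hA.1.2.1 I).2 ((bijective_vecMul_iff e _).2 hD)
    refine ⟨hdom, fun v => ?_⟩
    change _ = ev A (Matrix.vecMul (monomialRow P v.1) B.adjugate (e v.2)) / ev A B.det
    rw [hdet, hadj]
    exact eq_vecMul_adjugate_div e hD (vecMul_coord hJ hA.1.2.1 hdom v.1) v.2

/-! ### The inverse map -/

/-- The monomials `t^a e_i`, `a < μ_i`. -/
def standardMonomials {m : ℕ} (μ : Fin m → ℕ) : Finset (ℕ × Fin m) :=
  Finset.univ.image fun p : BlockIndex μ => (p.2.val, p.1)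

/-- The enumeration of the monomials `t^a e_i`, `a < μ_i`. -/
def standardEquiv {m : ℕ} (μ : Fin m → ℕ) : BlockIndex μ ≃ standardMonomials μ :=
  Equiv.ofBijective (fun p => ⟨(p.2.val, p.1), Finset.mem_image_of_mem _ (Finset.mem_univ p)⟩) (by
    constructor
    · rintro ⟨i, a⟩ ⟨j, b⟩ h
      obtain ⟨h1, h2⟩ := Prod.ext_iff.1 (Subtype.ext_iff.1 h)
      simp only at h1 h2
      subst h2
      rw [Fin.ext h1]
    · rintro ⟨v, hv⟩
      obtain ⟨p, -, rfl⟩ := Finset.mem_image.1 hv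
      exact ⟨p, rfl⟩)

/-- In the standard chart the coefficient matrix is the identity up to reindexing, so this single
chart contains the whole image. -/
theorem vecMul_monomialMatrix_standardMonomials {m : ℕ} {μ : Fin m → ℕ}
    {A : Matrix (BlockIndex μ) (BlockIndex μ) ℂ} (hA : IsJordanLike A) (hA' : A ∈ strictlyUpper μ)
    (d : standardMonomials μ → ℂ) :
    Matrix.vecMul d (monomialMatrix A (standardMonomials μ)) = d ∘ standardEquiv μ := by
  have hrow : ∀ p : BlockIndex μ, monomialRow A (p.2.val, p.1) = Pi.single p 1 := fun p =>
    (isTriangular_gSeries hA').eq_of_sub_mem (single_sub_monomialRow_mem hA (p.2.val, p.1)) (by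
      rw [blockVec_single, sub_self]
      exact zero_mem _)
  funext q
  rw [Matrix.vecMul, dotProduct, ← (standardEquiv μ).sum_comp, Finset.sum_eq_single q]
  · change _ * monomialRow A (q.2.val, q.1) q = _
    rw [hrow, Pi.single_eq_same, mul_one]
    rfl
  · intro p _ hp
    change _ * monomialRow A (p.2.val, p.1) q = _
    rw [hrow, Pi.single_eq_of_ne hp.symm, mul_zero]
  · simp

theorem mvMap_mem_dom_standardMonomials {m : ℕ} {μ : Fin m → ℕ}
    {A : Matrix (BlockIndex μ) (BlockIndex μ) ℂ} (hA : IsJordanLike A)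
    (hA' : A ∈ strictlyUpper μ) : mvMap μ A ∈ (grAtlas m).dom (standardMonomials μ) := by
  rw [mvMap_mem_dom_iff hA hA']
  have : (fun d : standardMonomials μ → ℂ =>
      Matrix.vecMul d (monomialMatrix A (standardMonomials μ))) =
      (standardEquiv μ).symm.arrowCongr (Equiv.refl ℂ) := by
    funext d
    rw [vecMul_monomialMatrix_standardMonomials hA hA']
    rfl
  rw [this]
  exact Equiv.bijective _

/-- The inverse of the Mirković–Vybornov map: the last rows of the blocks of `A` are the coordinates
of the classes of `t^{μ_j} e_j`. -/
def mvInv {m : ℕ} (μ : Fin m → ℕ) (L : LatticeSpace m) :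
    Matrix (BlockIndex μ) (BlockIndex μ) ℂ := fun p q =>
  if p.2.val + 1 = μ p.1 then
    (grAtlas m).coord (standardMonomials μ) L ((μ p.1, p.1), standardEquiv μ q)
  else jordanMatrix μ p q

theorem mvInv_mvMap {m : ℕ} {μ : Fin m → ℕ} {A : Matrix (BlockIndex μ) (BlockIndex μ) ℂ}
    (hA : IsJordanLike A) (hA' : A ∈ strictlyUpper μ) : mvInv μ (mvMap μ A) = A := by
  ext p q
  rw [mvInv]
  split_ifs with hp
  · have h0 : 0 < μ p.1 := by lia
    have h := vecMul_coord hA hA' (mvMap_mem_dom_standardMonomials hA hA') (μ p.1, p.1)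
    rw [vecMul_monomialMatrix_standardMonomials hA hA'] at h
    refine (congrFun h q).trans (congrFun ?_ q)
    -- Both rows represent t^{μ_i} e_i: one by powers of `A`, the other by column i of g(A).
    refine (isTriangular_gSeries hA').eq_of_sub_mem
      (single_sub_monomialRow_mem hA (μ p.1, p.1)) ?_
    have hp' : p = ⟨p.1, μ p.1 - 1, Nat.sub_lt h0 one_pos⟩ := by
      obtain ⟨i, a, ha⟩ := p
      simp only at hp
      simp only [Sigma.mk.injEq, heq_eq_eq, Fin.mk.injEq, true_and]
      lia
    have hcol := col_mem_colLattice (gSeries A) p.1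
    rwa [gSeries_col A h0, ← hp'] at hcol
  · exact (hA p q hp).symm

theorem isMorphism_mvInv {m : ℕ} {μ : Fin m → ℕ} (hdom : Antitone μ) {lam : YoungDiagram}
    (τ : SemistandardYoungTableau lam) :
    IsMorphism (grAtlas m) (matrixAtlas (BlockIndex μ)) (mvInv μ) (openZ μ τ) (openX μ τ) := by
  refine isMorphism_of_charts ?_ ?_
  · intro L hL
    obtain ⟨A, hA, rfl⟩ := exists_eq_mvMap_of_mem_openZ hdom hL
    rwa [mvInv_mvMap (isJordanLike_of_mem_slice hA.1) hA.2.1]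
  · intro L hL _ _
    -- Each entry of the inverse is a coordinate of the standard chart or a constant, so the
    -- denominator is 1.
    refine ⟨standardMonomials μ, ?_, 1, fun v => if v.1.2.val + 1 = μ v.1.1 then
      MvPolynomial.X ((μ v.1.1, v.1.1), standardEquiv μ v.2)
      else MvPolynomial.C (jordanMatrix μ v.1 v.2), ?_, ?_⟩
    · obtain ⟨A, hA, rfl⟩ := exists_eq_mvMap_of_mem_openZ hdom hL
      exact mvMap_mem_dom_standardMonomials (isJordanLike_of_mem_slice hA.1) hA.2.1
    · rw [map_one]
      exact one_ne_zero
    · refine fun L' _ _ => ⟨Set.mem_univ _, fun v => ?_⟩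
      rw [map_one, div_one]
      change mvInv μ L' v.1 v.2 = _
      change (if _ then _ else _) = MvPolynomial.eval _ (if _ then _ else _)
      rw [apply_ite (MvPolynomial.eval _)]
      exact (congrArg₂ (ite _) (MvPolynomial.eval_X _) (MvPolynomial.eval_C _)).symm

end MirkovicVybornov

end

open MirkovicVybornov
theorem mainTheorem7 (m : ℕ) (lam : YoungDiagram) (τ : SemistandardYoungTableau lam)
    (hτ : ∀ c ∈ lam.cells, τ c.1 c.2 < m)
    (μ : Fin m → ℕ) (hμ : ∀ i : Fin m, μ i = weight τ i) (hdom : Antitone μ) :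
    MapsIsomorphically (matrixAtlas (BlockIndex μ)) (grAtlas m) (mvMap μ) (openX μ τ) (openZ μ τ) := by
  refine ⟨isMorphism_mvMap μ τ, mvInv μ, isMorphism_mvInv hdom τ, fun A hA => ?_, fun L hL => ?_⟩
  · exact mvInv_mvMap (isJordanLike_of_mem_slice hA.1) hA.2.1
  · obtain ⟨A, hA, rfl⟩ := exists_eq_mvMap_of_mem_openZ hdom hL
    rw [mvInv_mvMap (isJordanLike_of_mem_slice hA.1) hA.2.1]
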